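/- Let $\mathcal X$ be a measurable space and $\mathbb P$ a probability distribution of $(X,A,Y)$ on $\mathcal X\times\{0,1\}\times\{0,1\}$ with $P_{1a}:=\mathbb P(Y=1,A=a)$ and $0<P_{10}\le P_{11}$. For a classifier $h:\mathcal X\to\{0,1\}$ let $$\mathcal R(h)=\mathbb P(h(X)\neq Y),\qquad \mathcal D^{opp}(h)=\big|\mathbb P(h(X)=1\mid A=0,Y=1)-\mathbb P(h(X)=1\mid A=1,Y=1)\big|.$$ Let $\mathcal H$ be a class of measurable classifiers of finite VC dimension $d$ that satisfies the usual measurability condition: for all $m$ and $v\in\{0,1\}^m$, the set of $(x_1,\dots,x_m)\in\mathcal X^m$ such that $(h(x_1),\dots,h(x_m))=v$ for some $h\in\mathcal H$ is measurable up to a null set of $Q^{\otimes m}$, for every probability measure $Q$ on $\mathcal X$ (this holds for instance for countable $\mathcal H$). Suppose that some $h^*\in\mathcal H$ satisfies both $\mathcal R(h^*)\le\mathcal R(h)$ and $\mathcal D^{opp}(h^*)\le\mathcal D^{opp}(h)$ for all $h\in\mathcal H$. Let $0<\alpha<\tfrac12$ and $\delta\in(0,1)$. Data are corrupted by a malicious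 adversary of power $\alpha$: a clean sample $((x^c_i,a^c_i,y^c_i))_{i=1}^n$ is drawn i.i.d. from $\mathbb P$; independently of it, each index is marked independently with probability $\alpha$; the adversary outputs a dataset $S^p=((x^p_i,a^p_i,y^p_i))_{i=1}^n$ that agrees with the clean sample at every unmarked index and is completely arbitrary (possibly randomized, and chosen with full knowledge of the clean data, the marks, $\mathbb P$ and the learner) at the marked ones. On $S^p$ put $$\widehat{\mathcal R}^p(h)=\frac1n\,\#\{i: h(x^p_i)\ne y^p_i\},\qquad \widehat{\mathcal D}^{opp}(h)=\left|\frac{\#\{i:h(x_i^p)=1,a_i^p=0,y_i^p=1\}}{\#\{i:a_i^p=0,y_i^p=1\}}-\frac{\#\{i:h(x_i^p)=1,a_i^p=1,y_i^p=1\}}{\#\{i:a_i^p=1,y_i^p=1\}}\right|$$ with the convention $0/0=0$, and let (reading $d\log(c/d)$ as $0$ when $d=0$) $$\Delta^{opp}=\frac{2\alpha}{P_{10}/3+\alpha},\quad r_n=\sqrt{\frac{8d\log(en/d)+2\log(16/\delta)}{n}},\quad s_n=\sqrt{\frac{2d\log(2en/d)+2\log(96/\delta)}{(1-\alpha)P_{10}\,n}},$$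 $$\mathcal H_1=\Big\{h\in\mathcal H:\widehat{\mathcal R}^p(h)-\min_{g\in\mathcal H}\widehat{\mathcal R}^p(g)\le 3\alpha+4r_n\Big\},\quad \mathcal H_3=\Big\{h\in\mathcal H:\widehat{\mathcal D}^{opp}(h)-\min_{g\in\mathcal H}\widehat{\mathcal D}^{opp}(g)\le 2\Delta^{opp}+32s_n\Big\}.$$ A component-wise learner $\mathcal L$ returns any element of $\mathcal H_1\cap\mathcal H_3$ if this set is non-empty, and any element of $\mathcal H$ otherwise. Then for every component-wise learner $\mathcal L$, every malicious adversary of power $\alpha$ and every $$n\ \ge\ \max\left\{\frac{8\log(16/\delta)}{(1-\alpha)P_{10}},\ \frac{12\log(12/\delta)}{\alpha},\ \frac d2\right\},$$ with probability at least $1-\delta$ over the clean data, the marks and the adversary's randomness, both $$\mathcal R(\mathcal L(S^p))-\mathcal R(h^*)\le 6\alpha+8r_n=6\alpha+\widetilde{\mathcal O}\Big(\sqrt{d/n}\Big)\quad\text{and}\quad \mathcal D^{opp}(\mathcal L(S^p))-\mathcal D^{opp}(h^*)\le 4\Delta^{opp}+64s_n=4\Delta^{opp}+\widetilde{\mathcal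 O}\Big(\sqrt{d/(P_{10}n)}\Big),$$ where $\widetilde{\mathcal O}$ hides absolute constants and logarithmic factors (in $n/d$ and $1/\delta$). -/

import Mathlib

open MeasureTheory ProbabilityTheory

namespace FairPAC

/-- A labelled example `(x, a, y)`: input, binary protected attribute, binary label. -/
abbrev Example (X : Type*) : Type _ := X × Fin 2 × Fin 2

/-- A dataset of size `n`. -/
abbrev Dataset (X : Type*) (n : ℕ) : Type _ := Fin n → Example X

/-- A binary classifier. -/
abbrev Classifier (X : Type*) : Type _ := X → Fin 2

section Hypotheses

variable {X : Type*}

/-- `H` realises every binary labelling of the finite set `s`. -/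
def Shatters (H : Set (Classifier X)) (s : Finset X) : Prop :=
  ∀ f : X → Fin 2, ∃ h ∈ H, ∀ x ∈ s, h x = f x

/-- The Vapnik-Chervonenkis dimension, possibly infinite. -/
noncomputable def vcDim (H : Set (Classifier X)) : ℕ∞ :=
  ⨆ (s : Finset X) (_ : Shatters H s), (s.card : ℕ∞)

/-- The usual measurability conditions on a hypothesis class: its members are measurable, and for
every labelling `v` of `m` points, the set of `m`-tuples on which some member of `H` realises `v`
is universally measurable (measurable up to null sets for i.i.d. sampling from any law).
Every countable class of measurable classifiers satisfies this, and so does every class whose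
members are pointwise limits of sequences in a fixed countable subclass. -/
structure MeasurableClass [MeasurableSpace X] (H : Set (Classifier X)) : Prop where
  measurable : ∀ h ∈ H, Measurable h
  trace : ∀ (Q : Measure X) [IsProbabilityMeasure Q] (m : ℕ) (v : Fin m → Fin 2),
    NullMeasurableSet {x : Fin m → X | ∃ h ∈ H, ∀ i, h (x i) = v i}
      (Measure.pi fun _ : Fin m => Q)

end Hypotheses

section Population

variable {X : Type*} [MeasurableSpace X]

/-- `ℙ(Y = 1, A = a)`. -/
noncomputable def posRate (P : Measure (Example X)) (a : Fin 2) : ℝ :=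
  P.real {z | z.2.1 = a ∧ z.2.2 = 1}

/-- The risk `ℙ(h(X) ≠ Y)`. -/
noncomputable def risk (P : Measure (Example X)) (h : Classifier X) : ℝ :=
  P.real {z | h z.1 ≠ z.2.2}

/-- The true positive rate `ℙ(h(X) = 1 | A = a, Y = 1)` in group `a`. -/
noncomputable def truePosRate (P : Measure (Example X)) (h : Classifier X) (a : Fin 2) : ℝ :=
  (P[|{z : Example X | z.2.1 = a ∧ z.2.2 = 1}]).real {z | h z.1 = 1}

/-- The equal opportunity deviation. -/
noncomputable def oppDev (P : Measure (Example X)) (h : Classifier X) : ℝ :=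
  |truePosRate P h 0 - truePosRate P h 1|

/-- The vector of the two objectives; `≤` on `ℝ × ℝ` is the component-wise order. -/
noncomputable def objectives (P : Measure (Example X)) (h : Classifier X) : ℝ × ℝ :=
  (risk P h, oppDev P h)

end Population

section Empirical

variable {X : Type*} {n : ℕ}

/-- The empirical risk of `h` on the dataset `S`. -/
noncomputable def empRisk (S : Dataset X n) (h : Classifier X) : ℝ :=
  (Finset.univ.filter fun i => h (S i).1 ≠ (S i).2.2).card / (n : ℝ)

/-- The empirical true positive rate in group `a`, with `0 / 0 = 0`. -/
noncomputable def empTruePosRate (S : Dataset X n) (h : Classifier X) (a : Fin 2) : ℝ :=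
  ((Finset.univ.filter fun i => h (S i).1 = 1 ∧ (S i).2.1 = a ∧ (S i).2.2 = 1).card : ℝ) /
    ((Finset.univ.filter fun i => (S i).2.1 = a ∧ (S i).2.2 = 1).card : ℝ)

/-- The empirical equal opportunity deviation. -/
noncomputable def empOppDev (S : Dataset X n) (h : Classifier X) : ℝ :=
  |empTruePosRate S h 0 - empTruePosRate S h 1|

/-- The members of `H` whose value of the empirical criterion `F` exceeds the minimum of `F` over
`H` by at most `t`. -/
def nearMinimizers (H : Set (Classifier X)) (F : Classifier X → ℝ) (t : ℝ) :
    Set (Classifier X) :=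
  {h | h ∈ H ∧ ∃ g ∈ H, (∀ g' ∈ H, F g ≤ F g') ∧ F h - F g ≤ t}

end Empirical

/-- The irreducible term `Δ^{opp} = 2 α / (p / 3 + α)`, where `p = ℙ(Y = 1, A = 0)`. -/
noncomputable def deltaOpp (α p : ℝ) : ℝ := 2 * α / (p / 3 + α)

/-- The statistical rate for the risk; `d * log (e n / d)` is `0` for `d = 0`. -/
noncomputable def riskRate (n d : ℕ) (δ : ℝ) : ℝ :=
  Real.sqrt ((8 * d * Real.log (Real.exp 1 * n / d) + 2 * Real.log (16 / δ)) / n)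

/-- The statistical rate for the equal opportunity deviation. -/
noncomputable def oppRate (n d : ℕ) (δ α p : ℝ) : ℝ :=
  Real.sqrt ((2 * d * Real.log (2 * Real.exp 1 * n / d) + 2 * Real.log (96 / δ)) /
    ((1 - α) * p * n))

/-- The hypotheses in `H` that are nearly optimal on `S` both in empirical risk and in empirical
equal opportunity deviation. -/
noncomputable def goodSet {X : Type*} {n : ℕ} (H : Set (Classifier X)) (d : ℕ) (δ α p : ℝ)
    (S : Dataset X n) : Set (Classifier X) :=
  nearMinimizers H (empRisk S) (3 * α + 4 * riskRate n d δ) ∩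
    nearMinimizers H (empOppDev S) (2 * deltaOpp α p + 32 * oppRate n d δ α p)

/-- `L` is a component-wise learner (on datasets of size `n`) for equal opportunity: it returns
some member of `goodSet` if there is one, and an arbitrary member of `H` otherwise. -/
structure IsComponentwiseLearner {X : Type*} {n : ℕ} (H : Set (Classifier X)) (d : ℕ)
    (δ α p : ℝ) (L : Dataset X n → Classifier X) : Prop where
  mem : ∀ S, L S ∈ H
  mem_goodSet : ∀ S, (goodSet H d δ α p S).Nonempty → L S ∈ goodSet H d δ α p S

/-- On the probability space `(Ω, μ)`, the dataset `Sp` arises from an i.i.d. sample `Sc` of `P`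
by a malicious adversary of power `α`: each index is marked independently with probability `α`,
independently of the clean data, and unmarked examples are left unchanged. Nothing is assumed on
the marked examples of `Sp`: they may depend on the clean data, the marks, everything else
in the problem, and additional randomness carried by `Ω`. -/
structure IsMaliciousCorruption {X Ω : Type*} [MeasurableSpace X] [MeasurableSpace Ω] {n : ℕ}
    (μ : Measure Ω) (P : Measure (Example X)) (α : ℝ) (Sc : Ω → Dataset X n)
    (marked : Ω → Fin n → Bool) (Sp : Ω → Dataset X n) : Prop where
  measurable_clean : Measurable Sc
  measurable_marked : Measurable marked
  clean_indep : iIndepFun (fun i ω => Sc ω i) μ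
  clean_law : ∀ i, μ.map (fun ω => Sc ω i) = P
  marked_indep : iIndepFun (fun i ω => marked ω i) μ
  marked_prob : ∀ i, μ.real {ω | marked ω i = true} = α
  clean_indep_marked : IndepFun Sc marked μ
  unmarked_eq : ∀ᵐ ω ∂μ, ∀ i, marked ω i = false → Sp ω i = Sc ω i

end FairPAC

open FairPAC

namespace FairPAC

/-! The adversary only controls the marked indices, so the proof separates a deterministic
perturbation bound from concentration of the pairs (mark, clean example). These are i.i.d. with a
known law whatever the adversary does (`IsMaliciousCorruption.map_marked_clean`). Outside one
unlikely event, `badSet`, both empirical criteria are uniformly close on `H` to their population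
values, for every admissible corruption at once. If the distance is at most `τ`, a population
minimiser is a `2 * τ`-near minimiser of the empirical criterion, and every such near minimiser is
`4 * τ`-optimal. As `hstar` minimises both criteria, it lies in both near-minimiser sets, so the
learner must choose from their intersection.

For the risk, at most `3 / 2 * α * n` indices are marked and each moves the error frequency by at
most `1 / n`; uniform convergence on the clean data gives the rest. For equal opportunity, let `C a`
be the number of unmarked positives of group `a` and `B a` the number of marked indices the
adversary turns into such positives. The extra examples move the rate of the group by at most `B a /
(B a + C a)`. Both groups share the budget `B 0 + B 1 ≤ 3 / 2 * α * n`, and `C a ≥ p * n / 4` with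
`p = posRate P 0`, so by concavity the total shift is at most `deltaOpp α p`.

Uniform convergence is the VC inequality `measure_exists_errCount_le`: ghost sample, random swaps,
Hoeffding for signs, and Sauer–Shelah. For the rates it is applied conditionally on the random set
of unmarked positives, on which the sample is i.i.d. (`measure_restrict_hits_mem_le`). -/

/-! ### Growth function of a VC class. -/

/-- The labellings of the points `x i` that are realised by `H`. -/
noncomputable def traces {X ι : Type*} [Fintype ι] (H : Set (Classifier X)) (x : ι → X) :
    Finset (ι → Fin 2) :=
  (Set.toFinite {v : ι → Fin 2 | ∃ h ∈ H, ∀ i, h (x i) = v i}).toFinset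

lemma mem_traces {X ι : Type*} [Fintype ι] {H : Set (Classifier X)} {x : ι → X}
    {v : ι → Fin 2} : v ∈ traces H x ↔ ∃ h ∈ H, ∀ i, h (x i) = v i := by
  simp [traces]

lemma card_le_of_shatters {X : Type*} {H : Set (Classifier X)} {d : ℕ} (hd : vcDim H = d)
    {s : Finset X} (hs : Shatters H s) : s.card ≤ d := by
  have h : (s.card : ℕ∞) ≤ vcDim H := le_iSup₂_of_le s hs le_rfl
  rw [hd] at h
  exact_mod_cast h

/-- The **Sauer–Shelah lemma** for the labellings of a finite family of points. -/
lemma card_traces_le {X ι : Type*} [Fintype ι] {H : Set (Classifier X)} {d : ℕ}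
    (hd : vcDim H = d) (x : ι → X) :
    (traces H x).card ≤ ∑ k ∈ Finset.range (d + 1), (Fintype.card ι).choose k := by
  classical
  -- A labelling is encoded by the set of indices labelled `1`, so that Sauer–Shelah for set
  -- families applies.
  set supp : (ι → Fin 2) → Finset ι := fun v => Finset.univ.filter fun i => v i = 1 with hsupp
  have hinj : Function.Injective supp := by
    intro v w hvw
    funext i
    have : i ∈ supp v ↔ i ∈ supp w := by rw [hvw]
    simp only [hsupp, Finset.mem_filter, Finset.mem_univ, true_and] at this
    rcases Fin.exists_fin_two.1 ⟨v i, rfl⟩ with h | h <;> grind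
  set 𝒜 := (traces H x).image supp with h𝒜
  have hvc : 𝒜.vcDim ≤ d := by
    refine Finset.sup_le fun s hs => ?_
    rw [Finset.mem_shatterer] at hs
    -- Repeated points always receive equal labels, so a shattered index set cannot contain a
    -- repetition and its image has the same size.
    have hx : Set.InjOn x s := by
      intro i hi j hj hij
      by_contra hne
      obtain ⟨u, hu, hsu⟩ := hs (t := {i}) (by simpa using hi)
      obtain ⟨v, hv, rfl⟩ := Finset.mem_image.1 hu
      obtain ⟨h, -, hh⟩ := mem_traces.1 hv
      have h1 : i ∈ s ∩ supp v := by rw [hsu]; simp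
      have h2 : j ∉ s ∩ supp v := by rw [hsu]; simpa using fun h => hne h.symm
      have hi1 : v i = 1 := by simpa [hsupp] using (Finset.mem_inter.1 h1).2
      have hj1 : v j ≠ 1 := by
        intro hj1
        exact h2 (Finset.mem_inter.2 ⟨hj, by simpa [hsupp] using hj1⟩)
      exact hj1 (by rw [← hh j, ← hij, hh i, hi1])
    rw [← Finset.card_image_of_injOn hx]
    refine card_le_of_shatters hd fun f => ?_
    obtain ⟨u, hu, hsu⟩ := hs (t := s.filter fun i => f (x i) = 1) (Finset.filter_subset _ _)
    obtain ⟨v, hv, rfl⟩ := Finset.mem_image.1 hu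
    obtain ⟨h, hH, hh⟩ := mem_traces.1 hv
    refine ⟨h, hH, fun y hy => ?_⟩
    obtain ⟨i, hi, rfl⟩ := Finset.mem_image.1 hy
    have := Finset.ext_iff.1 hsu i
    simp only [hsupp, Finset.mem_inter, Finset.mem_filter, hi, Finset.mem_univ, true_and] at this
    rw [hh i]
    grind
  calc (traces H x).card = 𝒜.card := (Finset.card_image_of_injective _ hinj).symm
    _ ≤ 𝒜.shatterer.card := Finset.card_le_card_shatterer 𝒜
    _ ≤ ∑ k ∈ Finset.Iic 𝒜.vcDim, (Fintype.card ι).choose k := Finset.card_shatterer_le_sum_vcDim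
    _ ≤ ∑ k ∈ Finset.range (d + 1), (Fintype.card ι).choose k :=
        Finset.sum_le_sum_of_subset fun k hk => by
          rw [Finset.mem_Iic] at hk
          rw [Finset.mem_range]
          omega

/-- Multiply by `(d / m) ^ d`: since `d / m ≤ 1`, the exponent may be lowered to `k`, and the sum
then completes to the binomial expansion of `(1 + d / m) ^ m ≤ exp d`. -/
lemma sum_choose_le_exp_mul_div_pow {m d : ℕ} (hdm : d ≤ m) :
    ((∑ k ∈ Finset.range (d + 1), m.choose k : ℕ) : ℝ) ≤ (Real.exp 1 * m / d) ^ d := by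
  rcases Nat.eq_zero_or_pos d with rfl | hd
  · simp
  have hd' : (0 : ℝ) < d := by exact_mod_cast hd
  have hm' : (0 : ℝ) < m := by exact_mod_cast hd.trans_le hdm
  have hq : (d : ℝ) / m ≤ 1 := by rw [div_le_one hm']; exact_mod_cast hdm
  have hq0 : (0 : ℝ) < (d : ℝ) / m := by positivity
  have key : ((∑ k ∈ Finset.range (d + 1), m.choose k : ℕ) : ℝ) * ((d : ℝ) / m) ^ d ≤
      Real.exp 1 ^ d := by
    calc ((∑ k ∈ Finset.range (d + 1), m.choose k : ℕ) : ℝ) * ((d : ℝ) / m) ^ d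
        = ∑ k ∈ Finset.range (d + 1), (m.choose k : ℝ) * ((d : ℝ) / m) ^ d := by
          push_cast; rw [Finset.sum_mul]
      _ ≤ ∑ k ∈ Finset.range (d + 1), (m.choose k : ℝ) * ((d : ℝ) / m) ^ k := by
          refine Finset.sum_le_sum fun k hk => ?_
          gcongr ?_ * ?_
          exact pow_le_pow_of_le_one hq0.le hq (by rw [Finset.mem_range] at hk; omega)
      _ ≤ ∑ k ∈ Finset.range (m + 1), (m.choose k : ℝ) * ((d : ℝ) / m) ^ k := by
          refine Finset.sum_le_sum_of_subset_of_nonneg (fun k hk => ?_) fun _ _ _ => by positivity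
          rw [Finset.mem_range] at *
          omega
      _ = ((d : ℝ) / m + 1) ^ m := by
          rw [add_pow]
          exact Finset.sum_congr rfl fun k _ => by simp [mul_comm]
      _ ≤ Real.exp ((d : ℝ) / m) ^ m := by
          gcongr
          exact Real.add_one_le_exp _
      _ = Real.exp 1 ^ d := by
          rw [← Real.exp_nat_mul, ← Real.exp_nat_mul]
          congr 1
          field_simp
  calc ((∑ k ∈ Finset.range (d + 1), m.choose k : ℕ) : ℝ)
      ≤ Real.exp 1 ^ d / ((d : ℝ) / m) ^ d := by rwa [le_div_iff₀ (by positivity)]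
    _ = (Real.exp 1 * m / d) ^ d := by
        rw [← div_pow]; congr 1; field_simp

/-- The shatter function of a class of dimension `d` is at most `(e m / d) ^ d`. -/
lemma card_traces_le_pow {X ι : Type*} [Fintype ι] {H : Set (Classifier X)} {d m : ℕ}
    (hd : vcDim H = d) (hdm : d ≤ m) (hι : Fintype.card ι ≤ m) (x : ι → X) :
    ((traces H x).card : ℝ) ≤ (Real.exp 1 * m / d) ^ d := by
  refine le_trans ?_ (sum_choose_le_exp_mul_div_pow hdm)
  exact_mod_cast (card_traces_le hd x).trans
    (Finset.sum_le_sum fun k _ => Nat.choose_le_choose k hι)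

/-! ### Concentration of random signs. -/

section Rademacher

variable {ι : Type*} [Fintype ι]

-- The sum over sign patterns factorises into hyperbolic cosines, and `cosh x ≤ exp (x ^ 2 / 2)`.
open Classical in
lemma sum_exp_sign_le (c : ι → ℝ) (hc : ∀ i, |c i| ≤ 1) (l : ℝ) :
    ∑ σ : ι → Bool, Real.exp (l * ∑ i, (if σ i then -c i else c i)) ≤
      2 ^ Fintype.card ι * Real.exp (Fintype.card ι * l ^ 2 / 2) := by
  have h1 : ∀ σ : ι → Bool, Real.exp (l * ∑ i, (if σ i then -c i else c i)) =
      ∏ i, Real.exp (l * (if σ i then -c i else c i)) := fun σ => by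
    rw [Finset.mul_sum, Real.exp_sum]
  have h2 : ∏ i, ∑ b : Bool, Real.exp (l * (if b then -c i else c i)) =
      ∑ σ : ι → Bool, ∏ i, Real.exp (l * (if σ i then -c i else c i)) := by
    rw [Finset.prod_univ_sum, Fintype.piFinset_univ]
  rw [Finset.sum_congr rfl fun σ _ => h1 σ, ← h2]
  calc ∏ i, ∑ b : Bool, Real.exp (l * (if b then -c i else c i))
      ≤ ∏ _i : ι, 2 * Real.exp (l ^ 2 / 2) := by
        refine Finset.prod_le_prod (fun i _ => by positivity) fun i _ => ?_
        have h3 : ∑ b : Bool, Real.exp (l * (if b then -c i else c i)) =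
            2 * Real.cosh (l * c i) := by
          rw [Fintype.sum_bool, Real.cosh_eq]
          simp only [if_true, Bool.false_eq_true, if_false, mul_neg]
          ring
        rw [h3]
        gcongr
        refine (Real.cosh_le_exp_half_sq _).trans ?_
        gcongr Real.exp (?_ / 2)
        rw [mul_pow]
        have : c i ^ 2 ≤ 1 := by
          rw [← sq_abs]; exact pow_le_one₀ (abs_nonneg _) (hc i)
        nlinarith [sq_nonneg l]
    _ = 2 ^ Fintype.card ι * Real.exp (Fintype.card ι * l ^ 2 / 2) := by
        rw [Finset.prod_const, Finset.card_univ, mul_pow, ← Real.exp_nat_mul]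
        congr 2
        ring

open Classical in
/-- **Hoeffding's inequality** for random signs, in counting form. -/
lemma card_signs_le [Nonempty ι] (c : ι → ℝ) (hc : ∀ i, |c i| ≤ 1) {t : ℝ} (ht : 0 ≤ t) :
    ((Finset.univ.filter fun σ : ι → Bool => t ≤ ∑ i, (if σ i then -c i else c i)).card : ℝ) ≤
      2 ^ Fintype.card ι * Real.exp (-(t ^ 2 / (2 * Fintype.card ι))) := by
  have hm : (0 : ℝ) < Fintype.card ι := by exact_mod_cast Fintype.card_pos
  set m : ℝ := (Fintype.card ι : ℝ) with hmdef
  -- This choice minimises the Chernoff exponent `m * l ^ 2 / 2 - l * t`.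
  set l := t / m with hl
  have hl0 : 0 ≤ l := by positivity
  have key : ((Finset.univ.filter fun σ : ι → Bool =>
      t ≤ ∑ i, (if σ i then -c i else c i)).card : ℝ) * Real.exp (l * t) ≤
      2 ^ Fintype.card ι * Real.exp (m * l ^ 2 / 2) := by
    refine le_trans ?_ (sum_exp_sign_le c hc l)
    rw [← nsmul_eq_mul, ← Finset.sum_const]
    refine (Finset.sum_le_sum fun σ hσ => ?_).trans
      (Finset.sum_le_sum_of_subset_of_nonneg (Finset.filter_subset _ _)
        fun _ _ _ => (Real.exp_pos _).le)
    exact Real.exp_le_exp.2 (mul_le_mul_of_nonneg_left (Finset.mem_filter.1 hσ).2 hl0)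
  rw [← le_div_iff₀ (Real.exp_pos _), mul_div_assoc, ← Real.exp_sub] at key
  have hexp : -(t ^ 2 / (2 * m)) = m * l ^ 2 / 2 - l * t := by
    rw [hl]
    field_simp
    ring
  rwa [hexp]

open Classical in
lemma card_abs_signs_le [Nonempty ι] (c : ι → ℝ) (hc : ∀ i, |c i| ≤ 1) {t : ℝ} (ht : 0 ≤ t) :
    ((Finset.univ.filter fun σ : ι → Bool =>
      t ≤ |∑ i, (if σ i then -c i else c i)|).card : ℝ) ≤
      2 * 2 ^ Fintype.card ι * Real.exp (-(t ^ 2 / (2 * Fintype.card ι))) := by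
  have h1 := card_signs_le c hc ht
  have h2 := card_signs_le (fun i => -c i) (fun i => by rw [abs_neg]; exact hc i) ht
  have h3 : (Finset.univ.filter fun σ : ι → Bool =>
      t ≤ |∑ i, (if σ i then -c i else c i)|) ⊆
      (Finset.univ.filter fun σ : ι → Bool => t ≤ ∑ i, (if σ i then -c i else c i)) ∪
      (Finset.univ.filter fun σ : ι → Bool => t ≤ ∑ i, (if σ i then - -c i else -c i)) := by
    intro σ hσ
    have hneg : ∑ i, (if σ i then - -c i else -c i) = -∑ i, (if σ i then -c i else c i) := by
      rw [← Finset.sum_neg_distrib]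
      exact Finset.sum_congr rfl fun i _ => by split_ifs <;> rfl
    simp only [Finset.mem_union, Finset.mem_filter, Finset.mem_univ, true_and] at hσ ⊢
    rw [hneg]
    exact le_abs.1 hσ
  have h4 := (Finset.card_le_card h3).trans (Finset.card_union_le _ _)
  have h5 : ((Finset.univ.filter fun σ : ι → Bool =>
      t ≤ |∑ i, (if σ i then -c i else c i)|).card : ℝ) ≤
      ((Finset.univ.filter fun σ : ι → Bool =>
        t ≤ ∑ i, (if σ i then -c i else c i)).card : ℝ) +
      ((Finset.univ.filter fun σ : ι → Bool =>
        t ≤ ∑ i, (if σ i then - -c i else -c i)).card : ℝ) := by exact_mod_cast h4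
  linarith

end Rademacher

/-! ### Exchangeability of a sample and its ghost. -/

section Swap

variable {ι Z : Type*}

/-- Exchange the `i`-th entries of two samples for those `i` with `σ i = true`. -/
def swapSample (σ : ι → Bool) (w : (ι → Z) × (ι → Z)) : (ι → Z) × (ι → Z) :=
  (fun i => if σ i then w.2 i else w.1 i, fun i => if σ i then w.1 i else w.2 i)

/-- A pair of samples is a sample of pairs, and swapping the two entries of a pair preserves `Q.prod
Q`. -/
lemma measurePreserving_swapSample [Fintype ι] [MeasurableSpace Z] (Q : Measure Z)
    [IsProbabilityMeasure Q] (σ : ι → Bool) :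
    MeasurePreserving (swapSample σ)
      ((Measure.pi fun _ : ι => Q).prod (Measure.pi fun _ : ι => Q))
      ((Measure.pi fun _ : ι => Q).prod (Measure.pi fun _ : ι => Q)) := by
  have he := measurePreserving_arrowProdEquivProdArrow Z Z ι (fun _ => Q) (fun _ => Q)
  have hf : ∀ i, MeasurePreserving (fun p : Z × Z => if σ i then p.swap else p)
      (Q.prod Q) (Q.prod Q) := fun i => by
    cases σ i
    · exact MeasurePreserving.id (Q.prod Q)
    · simpa using Measure.measurePreserving_swap (μ := Q) (ν := Q)
  have hpi := measurePreserving_pi (fun _ : ι => Q.prod Q) (fun _ : ι => Q.prod Q) hf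
  convert! he.comp (hpi.comp (he.symm _)) using 1
  funext w
  ext i <;> simp [swapSample, MeasurableEquiv.arrowProdEquivProdArrow,
    Equiv.arrowProdEquivProdArrow] <;> split_ifs <;> rfl

end Swap

/-! ### The Vapnik–Chervonenkis inequality. -/

section VC

variable {X ι : Type*} [Fintype ι]

/-- The zero-one loss. -/
noncomputable def zeroOne (a b : Fin 2) : ℝ := if a = b then 0 else 1

lemma zeroOne_mem_Icc (a b : Fin 2) : zeroOne a b ∈ Set.Icc (0 : ℝ) 1 := by
  unfold zeroOne
  split_ifs <;> simp

/-- The number of examples that `h` misclassifies. -/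
noncomputable def errCount (S : ι → Example X) (h : Classifier X) : ℝ :=
  ∑ i, zeroOne (h (S i).1) (S i).2.2

-- With the double sample fixed, a swap at `i` only flips the sign of the `i`-th loss difference,
-- and `H` matters only through its labellings of the points. A union bound over these labellings
-- reduces the claim to Hoeffding. The parameter `m` may exceed the size of the double sample, which
-- later allows samples of random size.
open Classical in
lemma card_swap_le [Nonempty ι] {H : Set (Classifier X)} {d m : ℕ} (hd : vcDim H = d)
    (hdm : d ≤ m) (hι : 2 * Fintype.card ι ≤ m) {t : ℝ} (ht : 0 ≤ t)
    (w : (ι → Example X) × (ι → Example X)) :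
    ((Finset.univ.filter fun σ : ι → Bool => ∃ h ∈ H,
      t ≤ |errCount (swapSample σ w).1 h - errCount (swapSample σ w).2 h|).card : ℝ) ≤
      (Real.exp 1 * m / d) ^ d *
        (2 * 2 ^ Fintype.card ι * Real.exp (-(t ^ 2 / (2 * Fintype.card ι)))) := by
  set x : ι ⊕ ι → X := Sum.elim (fun i => (w.1 i).1) (fun i => (w.2 i).1) with hx
  set c : (ι ⊕ ι → Fin 2) → ι → ℝ := fun v i =>
    zeroOne (v (Sum.inl i)) (w.1 i).2.2 - zeroOne (v (Sum.inr i)) (w.2 i).2.2 with hc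
  have hc1 : ∀ v i, |c v i| ≤ 1 := fun v i => by
    simp only [hc, zeroOne]
    split_ifs <;> norm_num
  have hsub : (Finset.univ.filter fun σ : ι → Bool => ∃ h ∈ H,
      t ≤ |errCount (swapSample σ w).1 h - errCount (swapSample σ w).2 h|) ⊆
      (traces H x).biUnion fun v => Finset.univ.filter fun σ : ι → Bool =>
        t ≤ |∑ i, (if σ i then -c v i else c v i)| := by
    intro σ hσ
    obtain ⟨h, hh, hle⟩ := (Finset.mem_filter.1 hσ).2
    rw [Finset.mem_biUnion]
    refine ⟨fun j => h (x j), mem_traces.2 ⟨h, hh, fun _ => rfl⟩, ?_⟩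
    rw [Finset.mem_filter]
    refine ⟨Finset.mem_univ _, hle.trans_eq ?_⟩
    congr 1
    rw [errCount, errCount, ← Finset.sum_sub_distrib]
    refine Finset.sum_congr rfl fun i _ => ?_
    simp only [hc, hx, swapSample, Sum.elim_inl, Sum.elim_inr]
    by_cases hσi : σ i = true <;> simp [hσi]
  have h1 : ((Finset.univ.filter fun σ : ι → Bool => ∃ h ∈ H,
      t ≤ |errCount (swapSample σ w).1 h - errCount (swapSample σ w).2 h|).card : ℝ) ≤
      ∑ v ∈ traces H x, ((Finset.univ.filter fun σ : ι → Bool =>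
        t ≤ |∑ i, (if σ i then -c v i else c v i)|).card : ℝ) := by
    exact_mod_cast (Finset.card_le_card hsub).trans Finset.card_biUnion_le
  refine h1.trans ((Finset.sum_le_sum fun v _ => card_abs_signs_le (c v) (hc1 v) ht).trans ?_)
  rw [Finset.sum_const, nsmul_eq_mul]
  gcongr
  exact card_traces_le_pow hd hdm (by rw [Fintype.card_sum]; omega) x

variable [MeasurableSpace X]

lemma MeasurableClass.nullMeasurableSet_trace {H : Set (Classifier X)} (hH : MeasurableClass H)
    (Q : Measure X) [IsProbabilityMeasure Q] (v : ι → Fin 2) :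
    NullMeasurableSet {x : ι → X | ∃ h ∈ H, ∀ i, h (x i) = v i} (Measure.pi fun _ => Q) := by
  set e := Fintype.equivFin ι
  have h := (hH.trace Q (Fintype.card ι) (v ∘ e.symm)).preimage
    (measurePreserving_piCongrLeft (fun _ : Fin (Fintype.card ι) => Q) e).quasiMeasurePreserving
  convert h using 1
  ext x
  simp only [Set.mem_ofPred_eq, Set.mem_preimage]
  refine exists_congr fun h => and_congr_right fun _ => ?_
  rw [← e.forall_congr_right]
  refine forall_congr' fun i => ?_
  have : (MeasurableEquiv.piCongrLeft (fun _ => X) e) x (e i) = x i :=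
    Equiv.piCongrLeft_apply_apply (P := fun _ => X) e x i
  rw [this]
  simp

/-- Two independent samples on which the numbers of errors of some member of `H` differ by at
least `t`. -/
def ghostSet (H : Set (Classifier X)) (t : ℝ) : Set ((ι → Example X) × (ι → Example X)) :=
  {w | ∃ h ∈ H, t ≤ |errCount w.1 h - errCount w.2 h|}

/-- The event is split according to the labelling `v` of the double sample. Each of the finitely
many pieces is a pulled-back trace event intersected with a measurable condition not involving `H`.
-/
lemma nullMeasurableSet_ghostSet {H : Set (Classifier X)} (hH : MeasurableClass H)
    (Q : Measure (Example X)) [IsProbabilityMeasure Q] (t : ℝ) :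
    NullMeasurableSet (ghostSet H t : Set ((ι → Example X) × (ι → Example X)))
      ((Measure.pi fun _ => Q).prod (Measure.pi fun _ => Q)) := by
  set Q' := Q.map Prod.fst with hQ'
  have : IsProbabilityMeasure Q' := Measure.isProbabilityMeasure_map measurable_fst.aemeasurable
  have hp : MeasurePreserving (fun (z : ι → Example X) i => (z i).1)
      (Measure.pi fun _ => Q) (Measure.pi fun _ => Q') :=
    measurePreserving_pi (fun _ => Q) (fun _ => Q') fun _ => measurable_fst.measurePreserving Q
  have hs := (measurePreserving_sumPiEquivProdPi (fun _ : ι ⊕ ι => Q')).symm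
  have hcomb := hs.comp (hp.prod hp)
  have heq : (ghostSet H t : Set ((ι → Example X) × (ι → Example X))) =
      ⋃ v : ι ⊕ ι → Fin 2,
        ((MeasurableEquiv.sumPiEquivProdPi fun _ : ι ⊕ ι => X).symm ∘
          Prod.map (fun (z : ι → Example X) i => (z i).1) (fun z i => (z i).1)) ⁻¹'
            {x | ∃ h ∈ H, ∀ i, h (x i) = v i} ∩
        {w | t ≤ |∑ i, zeroOne (v (Sum.inl i)) (w.1 i).2.2 -
          ∑ i, zeroOne (v (Sum.inr i)) (w.2 i).2.2|} := by
    ext w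
    simp only [ghostSet, Set.mem_ofPred_eq, Set.mem_iUnion, Set.mem_inter_iff, Set.mem_preimage]
    constructor
    · rintro ⟨h, hh, hle⟩
      exact ⟨Sum.elim (fun i => h (w.1 i).1) (fun i => h (w.2 i).1),
        ⟨h, hh, by rintro (i | i) <;> rfl⟩, hle⟩
    · rintro ⟨v, ⟨h, hh, hv⟩, hle⟩
      refine ⟨h, hh, hle.trans_eq ?_⟩
      have hl : ∀ i, h (w.1 i).1 = v (Sum.inl i) := fun i => hv (Sum.inl i)
      have hr : ∀ i, h (w.2 i).1 = v (Sum.inr i) := fun i => hv (Sum.inr i)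
      simp only [errCount, hl, hr]
  rw [heq]
  refine NullMeasurableSet.iUnion fun v => NullMeasurableSet.inter ?_ ?_
  · exact (hH.nullMeasurableSet_trace Q' v).preimage hcomb.quasiMeasurePreserving
  · refine MeasurableSet.nullMeasurableSet (measurableSet_le measurable_const ?_)
    have hz : ∀ a : Fin 2, Measurable (zeroOne a) := fun a => Measurable.of_discrete
    have hl : Measurable fun w : (ι → Example X) × (ι → Example X) =>
        ∑ i, zeroOne (v (Sum.inl i)) (w.1 i).2.2 :=
      Finset.measurable_sum _ fun i _ => (hz _).comp (by fun_prop)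
    have hr : Measurable fun w : (ι → Example X) × (ι → Example X) =>
        ∑ i, zeroOne (v (Sum.inr i)) (w.2 i).2.2 :=
      Finset.measurable_sum _ fun i _ => (hz _).comp (by fun_prop)
    exact _root_.continuous_abs.measurable.comp (hl.sub hr)

end VC

section VC

variable {X ι : Type*} [Fintype ι] [MeasurableSpace X]

/-- By swap invariance the probability equals its average over all `σ`; exchanging sum and integral
leaves the pointwise count bounded in `card_swap_le`. -/
lemma measure_ghostSet_le [Nonempty ι] {H : Set (Classifier X)} (hH : MeasurableClass H)
    {d m : ℕ} (hd : vcDim H = d) (hdm : d ≤ m) (hι : 2 * Fintype.card ι ≤ m)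
    (Q : Measure (Example X)) [IsProbabilityMeasure Q] {t : ℝ} (ht : 0 ≤ t) :
    ((Measure.pi fun _ : ι => Q).prod (Measure.pi fun _ : ι => Q)) (ghostSet H t) ≤
      ENNReal.ofReal ((Real.exp 1 * m / d) ^ d *
        (2 * Real.exp (-(t ^ 2 / (2 * Fintype.card ι))))) := by
  classical
  set ν := (Measure.pi fun _ : ι => Q).prod (Measure.pi fun _ : ι => Q) with hν
  set T : Set ((ι → Example X) × (ι → Example X)) := ghostSet H t with hT
  have hTm : NullMeasurableSet T ν := nullMeasurableSet_ghostSet hH Q t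
  set K : ℝ := (Real.exp 1 * m / d) ^ d *
        (2 * Real.exp (-(t ^ 2 / (2 * Fintype.card ι)))) with hK
  have hpre : ∀ σ : ι → Bool, NullMeasurableSet (swapSample σ ⁻¹' T) ν := fun σ =>
    hTm.preimage (measurePreserving_swapSample Q σ).quasiMeasurePreserving
  have h1 : (2 ^ Fintype.card ι : ENNReal) * ν T = ∑ σ : ι → Bool, ν (swapSample σ ⁻¹' T) := by
    rw [Finset.sum_congr rfl fun σ _ =>
      (measurePreserving_swapSample Q σ).measure_preimage hTm, Finset.sum_const]
    simp [hν]
  have h2 : ∑ σ : ι → Bool, ν (swapSample σ ⁻¹' T) =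
      ∫⁻ w, ∑ σ : ι → Bool, (swapSample σ ⁻¹' T).indicator (fun _ => (1 : ENNReal)) w ∂ν := by
    rw [lintegral_finsetSum' _ fun σ _ => (aemeasurable_const (b := (1 : ENNReal))).indicator₀
      (hpre σ)]
    refine Finset.sum_congr rfl fun σ _ => ?_
    exact (lintegral_indicator_one₀ (hpre σ)).symm
  have h3 : ∫⁻ w, ∑ σ : ι → Bool, (swapSample σ ⁻¹' T).indicator (fun _ => (1 : ENNReal)) w ∂ν ≤
      ∫⁻ _, (2 ^ Fintype.card ι : ENNReal) * ENNReal.ofReal K ∂ν := by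
    refine lintegral_mono fun w => ?_
    have hsum : ∑ σ : ι → Bool, (swapSample σ ⁻¹' T).indicator (fun _ => (1 : ENNReal)) w =
        ((Finset.univ.filter fun σ : ι → Bool => ∃ h ∈ H,
          t ≤ |errCount (swapSample σ w).1 h - errCount (swapSample σ w).2 h|).card : ENNReal) := by
      rw [Finset.card_filter, Nat.cast_sum]
      refine Finset.sum_congr rfl fun σ _ => ?_
      simp only [Set.indicator_apply, Set.mem_preimage, hT, ghostSet, Set.mem_ofPred_eq,
        Nat.cast_ite, Nat.cast_one, Nat.cast_zero]
    have hcard := card_swap_le hd hdm hι ht w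
    rw [hsum, ← ENNReal.ofReal_natCast]
    refine (ENNReal.ofReal_le_ofReal hcard).trans_eq ?_
    rw [show (2 ^ Fintype.card ι : ENNReal) = ENNReal.ofReal (2 ^ Fintype.card ι) by
      rw [ENNReal.ofReal_pow (by norm_num)]; simp, ← ENNReal.ofReal_mul (by positivity)]
    congr 1
    rw [hK]
    ring
  rw [lintegral_const, measure_univ, mul_one, ← h2, ← h1] at h3
  exact (ENNReal.mul_le_mul_iff_right (by simp) (by simp)).1 h3

lemma integral_zeroOne {h : Classifier X} (hh : Measurable h) (Q : Measure (Example X)) :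
    ∫ z, zeroOne (h z.1) z.2.2 ∂Q = risk Q h := by
  have hs : MeasurableSet {z : Example X | h z.1 ≠ z.2.2} :=
    (measurableSet_eq_fun (hh.comp measurable_fst) (by fun_prop)).compl
  rw [risk, ← integral_indicator_one hs]
  congr 1
  funext z
  by_cases hz : h z.1 = z.2.2 <;> simp [zeroOne, hz]

lemma measurable_zeroOne_comp {h : Classifier X} (hh : Measurable h) :
    Measurable fun z : Example X => zeroOne (h z.1) z.2.2 := by
  have : Measurable fun p : Fin 2 × Fin 2 => zeroOne p.1 p.2 := Measurable.of_discrete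
  exact this.comp ((hh.comp measurable_fst).prodMk (by fun_prop))

/-- **Chebyshev's inequality** for the number of errors of a fixed classifier. -/
lemma measure_errCount_ge_le (Q : Measure (Example X)) [IsProbabilityMeasure Q]
    {h : Classifier X} (hh : Measurable h) {t : ℝ} (ht : 0 < t)
    (hkt : Fintype.card ι ≤ 2 * t ^ 2) :
    (Measure.pi fun _ : ι => Q) {z | t ≤ |errCount z h - Fintype.card ι * risk Q h|} ≤ 1 / 2 := by
  have hm := measurable_zeroOne_comp hh
  set f : Example X → ℝ := fun z => zeroOne (h z.1) z.2.2 with hf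
  have hfL : MemLp f 2 Q := MemLp.of_bound hm.aestronglyMeasurable 1
    (ae_of_all _ fun z => by
      have := zeroOne_mem_Icc (h z.1) z.2.2
      rw [Real.norm_eq_abs, abs_of_nonneg this.1]
      exact this.2)
  have hL : ∀ i : ι, MemLp (fun z : ι → Example X => f (z i)) 2 (Measure.pi fun _ => Q) :=
    fun i => hfL.comp_measurePreserving (measurePreserving_eval (fun _ => Q) i)
  have hvar : Var[∑ i, fun z : ι → Example X => f (z i); Measure.pi fun _ => Q] ≤
      Fintype.card ι * (1 / 4) := by
    rw [variance_sum_pi (X := fun _ => f) fun _ => hfL, Finset.sum_const, nsmul_eq_mul,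
      Finset.card_univ]
    have hb : ∀ᵐ z ∂Q, f z ∈ Set.Icc (0 : ℝ) 1 := ae_of_all _ fun z => zeroOne_mem_Icc _ _
    have hv : Var[f; Q] ≤ 1 / 4 :=
      (variance_le_sq_of_bounded hb hm.aemeasurable).trans_eq (by norm_num)
    exact mul_le_mul_of_nonneg_left hv (Nat.cast_nonneg _)
  have hmean : ∫ z, (∑ i, fun z : ι → Example X => f (z i)) z ∂(Measure.pi fun _ : ι => Q) =
      Fintype.card ι * risk Q h := by
    simp only [Finset.sum_apply]
    have hI : ∀ i : ι, Integrable (fun z : ι → Example X => f (z i)) (Measure.pi fun _ => Q) :=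
      fun i => (hL i).integrable one_le_two
    rw [integral_finsetSum _ fun i _ => hI i]
    have : ∀ i : ι, ∫ z, f (z i) ∂(Measure.pi fun _ : ι => Q) = risk Q h := fun i =>
      (integral_comp_eval (μ := fun _ : ι => Q) hm.aestronglyMeasurable).trans
        (integral_zeroOne hh Q)
    rw [Finset.sum_congr rfl fun i _ => this i]
    simp
  have hc := meas_ge_le_variance_div_sq (memLp_finsetSum' Finset.univ fun i _ => hL i) ht
  rw [hmean] at hc
  have hset : {z : ι → Example X | t ≤ |errCount z h - Fintype.card ι * risk Q h|} =
      {z | t ≤ |(∑ i, fun z : ι → Example X => f (z i)) z - Fintype.card ι * risk Q h|} := by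
    ext z
    simp [errCount, hf]
  rw [hset]
  refine hc.trans ?_
  rw [show (1 / 2 : ENNReal) = ENNReal.ofReal (1 / 2) by
    rw [ENNReal.ofReal_div_of_pos two_pos]; simp]
  refine ENNReal.ofReal_le_ofReal ?_
  rw [div_le_iff₀ (by positivity)]
  linarith

/-- The **Vapnik–Chervonenkis inequality**: uniform convergence of error frequencies. -/
theorem measure_exists_errCount_le [Nonempty ι] {H : Set (Classifier X)} (hH : MeasurableClass H)
    {d m : ℕ} (hd : vcDim H = d) (hdm : d ≤ m) (hι : 2 * Fintype.card ι ≤ m)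
    (Q : Measure (Example X)) [IsProbabilityMeasure Q] {t : ℝ} (ht : 0 < t)
    (hkt : Fintype.card ι ≤ 2 * t ^ 2) :
    (Measure.pi fun _ : ι => Q)
        {z | ∃ h ∈ H, 2 * t < |errCount z h - Fintype.card ι * risk Q h|} ≤
      ENNReal.ofReal (4 * (Real.exp 1 * m / d) ^ d *
        Real.exp (-(t ^ 2 / (2 * Fintype.card ι)))) := by
  set π := Measure.pi fun _ : ι => Q with hπ
  -- The ghost event is only null-measurable; a measurable hull has measurable fibres and the same
  -- measure.
  set T := toMeasurable (π.prod π) (ghostSet H t) with hT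
  have hTm : MeasurableSet T := measurableSet_toMeasurable _ _
  have hsub : {z | ∃ h ∈ H, 2 * t < |errCount z h - Fintype.card ι * risk Q h|} ⊆
      {z | 1 / 2 ≤ π (Prod.mk z ⁻¹' T)} := by
    rintro z ⟨h, hh, hz⟩
    have hc := measure_errCount_ge_le (ι := ι) Q (hH.measurable h hh) ht hkt
    -- If `h` is off by more than `2 * t` on `z` and by less than `t` on `z'`, the two counts differ
    -- by more than `t`. By Chebyshev such `z'` have mass at least `1 / 2`, so Markov's inequality
    -- for the fibre measure costs a factor `2`.
    have hcover : {z' | t ≤ |errCount z' h - Fintype.card ι * risk Q h|} ∪ Prod.mk z ⁻¹' T =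
        Set.univ := by
      refine Set.eq_univ_of_forall fun z' => ?_
      by_cases hz' : t ≤ |errCount z' h - Fintype.card ι * risk Q h|
      · exact Or.inl hz'
      · refine Or.inr (subset_toMeasurable _ _ ⟨h, hh, ?_⟩)
        have := abs_sub_abs_le_abs_sub (errCount z h - Fintype.card ι * risk Q h)
          (errCount z' h - Fintype.card ι * risk Q h)
        rw [sub_sub_sub_cancel_right] at this
        simp only
        linarith
    have h1 : (1 : ENNReal) ≤ 1 / 2 + π (Prod.mk z ⁻¹' T) := by
      have hu := measure_union_le (μ := π)
        {z' | t ≤ |errCount z' h - Fintype.card ι * risk Q h|} (Prod.mk z ⁻¹' T)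
      rw [hcover, measure_univ] at hu
      exact hu.trans (by gcongr)
    have h2 : (1 / 2 + 1 / 2 : ENNReal) = 1 := ENNReal.add_halves 1
    have h3 : (1 / 2 : ENNReal) + 1 / 2 ≤ 1 / 2 + π (Prod.mk z ⁻¹' T) := h2.trans_le h1
    exact (ENNReal.add_le_add_iff_left (by simp)).1 h3
  have hmark := mul_meas_ge_le_lintegral₀ (μ := π)
    (measurable_measure_prodMk_left (ν := π) hTm).aemeasurable (1 / 2)
  rw [← Measure.prod_apply hTm, hT, measure_toMeasurable] at hmark
  have hghost := measure_ghostSet_le (ι := ι) hH hd hdm hι Q ht.le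
  calc π {z | ∃ h ∈ H, 2 * t < |errCount z h - Fintype.card ι * risk Q h|}
      ≤ π {z | 1 / 2 ≤ π (Prod.mk z ⁻¹' T)} := measure_mono hsub
    _ = 2 * (1 / 2 * π {z | 1 / 2 ≤ π (Prod.mk z ⁻¹' T)}) := by
        rw [← mul_assoc, one_div, ENNReal.mul_inv_cancel (by simp) (by simp), one_mul]
    _ ≤ 2 * ENNReal.ofReal ((Real.exp 1 * m / d) ^ d *
        (2 * Real.exp (-(t ^ 2 / (2 * Fintype.card ι))))) := by
        gcongr
        exact hmark.trans hghost
    _ = _ := by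
        rw [show (2 : ENNReal) = ENNReal.ofReal 2 by simp, ← ENNReal.ofReal_mul (by norm_num)]
        congr 1
        ring

end VC

/-! ### Number and conditional law of the sample points in an event. -/

section Hits

variable {ι W : Type*} [Fintype ι]

/-- The indices at which the sample `w` falls into `G`. -/
noncomputable def hits (G : Set W) (w : ι → W) : Finset ι :=
  (Set.toFinite {i | w i ∈ G}).toFinset

@[simp]
lemma mem_hits {G : Set W} {w : ι → W} {i : ι} : i ∈ hits G w ↔ w i ∈ G := by
  simp [hits]

open Classical in
lemma card_hits (G : Set W) (w : ι → W) :
    ((hits G w).card : ℝ) = ∑ i, G.indicator (fun _ => (1 : ℝ)) (w i) := by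
  have : hits G w = Finset.univ.filter fun i => w i ∈ G := by ext; simp
  rw [this, Finset.card_filter, Nat.cast_sum]
  exact Finset.sum_congr rfl fun i _ => by simp [Set.indicator_apply]

lemma exp_mul_card_hits (G : Set W) (l : ℝ) (w : ι → W) :
    Real.exp (l * (hits G w).card) =
      ∏ i, Real.exp (l * G.indicator (fun _ => (1 : ℝ)) (w i)) := by
  rw [card_hits, Finset.mul_sum, Real.exp_sum]

variable [MeasurableSpace W]

lemma measurable_card_hits {G : Set W} (hG : MeasurableSet G) :
    Measurable fun w : ι → W => ((hits G w).card : ℝ) := by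
  simp only [card_hits]
  exact Finset.measurable_sum _ fun i _ =>
    (measurable_const.indicator hG).comp (measurable_pi_apply i)

/-- The indicators are independent, and each has moment generating function `1 + p * (exp l - 1) ≤
exp (p * (exp l - 1))`. -/
lemma mgf_card_hits_le (R : Measure W) [IsProbabilityMeasure R] {G : Set W}
    (hG : MeasurableSet G) (l : ℝ) :
    mgf (fun w : ι → W => ((hits G w).card : ℝ)) (Measure.pi fun _ => R) l ≤
      Real.exp (Fintype.card ι * R.real G * (Real.exp l - 1)) := by
  have h1 : ∀ z : W, Real.exp (l * G.indicator (fun _ => (1 : ℝ)) z) =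
      1 + G.indicator (fun _ => Real.exp l - 1) z := fun z => by
    by_cases hz : z ∈ G <;> simp [hz]
  have h2 : ∫ z, Real.exp (l * G.indicator (fun _ => (1 : ℝ)) z) ∂(R) =
      1 + R.real G * (Real.exp l - 1) := by
    simp only [h1]
    rw [integral_add (integrable_const _) ((integrable_const _).indicator hG),
      integral_indicator_const _ hG]
    simp
  simp only [mgf, exp_mul_card_hits]
  rw [integral_fintype_prod_eq_prod (𝕜 := ℝ)
    (fun _ : ι => fun z : W => Real.exp (l * G.indicator (fun _ => (1 : ℝ)) z)) (μ := fun _ => R)]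
  rw [h2, Finset.prod_const, Finset.card_univ, mul_assoc, Real.exp_nat_mul]
  have h0 : 0 ≤ 1 + R.real G * (Real.exp l - 1) := by
    rw [← h2]
    exact integral_nonneg fun _ => (Real.exp_pos _).le
  refine pow_le_pow_left₀ h0 ?_ _
  rw [add_comm]
  exact Real.add_one_le_exp _

lemma integrable_exp_mul_card_hits (R : Measure W) [IsProbabilityMeasure R] {G : Set W}
    (hG : MeasurableSet G) (l : ℝ) :
    Integrable (fun w : ι → W => Real.exp (l * (hits G w).card)) (Measure.pi fun _ => R) := by
  refine Integrable.of_bound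
    ((measurable_card_hits hG).const_mul l).exp.aestronglyMeasurable
    (Real.exp (|l| * Fintype.card ι)) (ae_of_all _ fun w => ?_)
  rw [Real.norm_eq_abs, abs_of_pos (Real.exp_pos _)]
  refine Real.exp_le_exp.2 ?_
  have : ((hits G w).card : ℝ) ≤ Fintype.card ι := by exact_mod_cast Finset.card_le_univ _
  calc l * (hits G w).card ≤ |l| * (hits G w).card := by
        gcongr
        exact le_abs_self l
    _ ≤ _ := by gcongr

/-- The multiplicative **Chernoff bound**, upper tail. -/
lemma measure_card_hits_ge_le (R : Measure W) [IsProbabilityMeasure R] {G : Set W}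
    (hG : MeasurableSet G) :
    (Measure.pi fun _ : ι => R).real
        {w | 3 / 2 * (Fintype.card ι * R.real G) ≤ (hits G w).card} ≤
      Real.exp (-(Fintype.card ι * R.real G) / 12) := by
  -- With mean `M` and parameter `2 / 5`, the exponent is at most `-(3 / 5) * M + M / 2 = -M / 10`.
  have hexp : Real.exp (2 / 5) ≤ 3 / 2 := by
    have h5 : Real.exp (2 / 5) ^ 5 ≤ (3 / 2) ^ 5 := by
      have h1 := Real.exp_one_lt_d9.le
      have h2 : Real.exp (2 / 5) ^ 5 = Real.exp 1 ^ 2 := by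
        rw [← Real.exp_nat_mul, ← Real.exp_nat_mul]
        norm_num
      rw [h2]
      calc Real.exp 1 ^ 2 ≤ (2.7182818286 : ℝ) ^ 2 := by gcongr
        _ ≤ _ := by norm_num
    exact le_of_pow_le_pow_left₀ (by norm_num) (by norm_num) h5
  refine (measure_ge_le_exp_mul_mgf (t := 2 / 5) _ (by norm_num)
    (integrable_exp_mul_card_hits R hG _)).trans ?_
  refine (mul_le_mul_of_nonneg_left (mgf_card_hits_le R hG _) (Real.exp_pos _).le).trans ?_
  rw [← Real.exp_add]
  refine Real.exp_le_exp.2 ?_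
  have hm : 0 ≤ Fintype.card ι * R.real G := by positivity
  nlinarith

/-- The multiplicative **Chernoff bound**, lower tail. -/
lemma measure_card_hits_le_le (R : Measure W) [IsProbabilityMeasure R] {G : Set W}
    (hG : MeasurableSet G) :
    (Measure.pi fun _ : ι => R).real
        {w | (hits G w).card ≤ Fintype.card ι * R.real G / 2} ≤
      Real.exp (-(Fintype.card ι * R.real G) / 8) := by
  -- With mean `M`, parameter `-log 2` gives the exponent `(log 2 - 1) * M / 2`, which is below `-M
  -- / 8`.
  refine (measure_le_le_exp_mul_mgf (t := -Real.log 2) _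
    (neg_nonpos.2 (Real.log_nonneg (by norm_num))) (integrable_exp_mul_card_hits R hG _)).trans ?_
  refine (mul_le_mul_of_nonneg_left (mgf_card_hits_le R hG _) (Real.exp_pos _).le).trans ?_
  rw [← Real.exp_add, Real.exp_neg, Real.exp_log two_pos]
  refine Real.exp_le_exp.2 ?_
  have hm : 0 ≤ Fintype.card ι * R.real G := by positivity
  have := Real.log_two_lt_d9
  nlinarith

lemma pi_cond_const (R : Measure W) [IsProbabilityMeasure R] {G : Set W} (hG : MeasurableSet G)
    (hG0 : R G ≠ 0) :
    (Measure.pi fun _ : ι => R[|G]) = (Measure.pi fun _ : ι => R)[|Set.univ.pi fun _ => G] := by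
  have : IsProbabilityMeasure (R[|G]) := cond_isProbabilityMeasure hG0
  refine Measure.pi_eq fun s hs => ?_
  have hGpi : MeasurableSet (Set.univ.pi fun _ : ι => G) := MeasurableSet.univ_pi fun _ => hG
  rw [cond_apply hGpi, ← Set.pi_inter_distrib, Measure.pi_pi, Measure.pi_pi,
    ENNReal.prod_inv_distrib fun _ _ _ _ _ => Or.inl hG0, ← Finset.prod_mul_distrib]
  exact Finset.prod_congr rfl fun i _ => (cond_apply hG R (s i)).symm

/-- Conditionally on the set `I` of indices falling into `G`, the restriction of an i.i.d. sample
to `I` is i.i.d. from the conditional law given `G`. -/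
lemma measure_restrict_hits_mem_le (R : Measure W) [IsProbabilityMeasure R] {G : Set W}
    (hG : MeasurableSet G) (hG0 : R G ≠ 0) (B : ∀ I : Finset ι, Set (I → W)) {η : ENNReal}
    (hB : ∀ I : Finset ι, (Measure.pi fun _ : I => R[|G]) (B I) ≤ η) :
    (Measure.pi fun _ : ι => R) {w | (fun i : hits G w => w i) ∈ B (hits G w)} ≤ η := by
  classical
  have : IsProbabilityMeasure (R[|G]) := cond_isProbabilityMeasure hG0
  set π := Measure.pi fun _ : ι => R with hπ
  -- No measurability of `B` is assumed, so measurable hulls for the conditional laws replace it.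
  set B' : ∀ I : Finset ι, Set (I → W) := fun I =>
    toMeasurable (Measure.pi fun _ : I => R[|G]) (B I) with hB'
  have hB'm : ∀ I, MeasurableSet (B' I) := fun I => measurableSet_toMeasurable _ _
  -- Splitting coordinates into `I` and its complement turns the event into a rectangle, so the
  -- coordinates outside `I` contribute only a constant factor.
  have hpre : ∀ I : Finset ι, ∀ C : Set (I → W),
      {w : ι → W | hits G w = I ∧ (fun i : I => w i) ∈ C} =
      (MeasurableEquiv.piEquivPiSubtypeProd (fun _ : ι => W) (· ∈ I)) ⁻¹'
        (((Set.univ.pi fun _ => G) ∩ C) ×ˢ (Set.univ.pi fun _ => Gᶜ)) := by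
    intro I C
    ext w
    simp only [Set.mem_ofPred_eq, Set.mem_preimage, Set.mem_prod, Set.mem_inter_iff,
      Set.mem_univ_pi, Finset.ext_iff, mem_hits, Set.mem_compl_iff]
    constructor
    · rintro ⟨h1, h2⟩
      exact ⟨⟨fun i => (h1 i).2 i.2, h2⟩, fun i hi => i.2 ((h1 i).1 hi)⟩
    · rintro ⟨⟨h1, h2⟩, h3⟩
      exact ⟨fun i => ⟨fun hi => by_contra fun hn => h3 ⟨i, hn⟩ hi, fun hi => h1 ⟨i, hi⟩⟩, h2⟩
  have hval : ∀ I : Finset ι, ∀ C : Set (I → W), MeasurableSet C →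
      π {w : ι → W | hits G w = I ∧ (fun i : I => w i) ∈ C} =
      (Measure.pi fun _ : I => R) ((Set.univ.pi fun _ => G) ∩ C) *
        (Measure.pi fun _ : {i // i ∉ I} => R) (Set.univ.pi fun _ => Gᶜ) := by
    intro I C hC
    have hm : MeasurableSet ((Set.univ.pi fun _ : I => G) ∩ C) :=
      (MeasurableSet.univ_pi fun _ => hG).inter hC
    have hm2 : MeasurableSet (Set.univ.pi fun _ : {i // i ∉ I} => Gᶜ) :=
      MeasurableSet.univ_pi fun _ => hG.compl
    rw [hpre, (measurePreserving_piEquivPiSubtypeProd (fun _ : ι => R) (· ∈ I)).measure_preimage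
      (hm.prod hm2).nullMeasurableSet]
    rw [Subsingleton.elim (Finset.Subtype.fintype I) (Subtype.fintype (· ∈ I)), Measure.prod_prod]
  have hhits : ∀ I : Finset ι, MeasurableSet ((fun w : ι → W => hits G w) ⁻¹' {I}) := fun I => by
    have := hpre I Set.univ
    simp only [Set.mem_univ, and_true, Set.inter_univ] at this
    have h2 : (fun w : ι → W => hits G w) ⁻¹' {I} = {w | hits G w = I} := rfl
    rw [h2, this]
    exact (MeasurableEquiv.piEquivPiSubtypeProd (fun _ : ι => W) (· ∈ I)).measurable
      ((MeasurableSet.univ_pi fun _ => hG).prod (MeasurableSet.univ_pi fun _ => hG.compl))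
  have hbound : ∀ I : Finset ι,
      π {w : ι → W | hits G w = I ∧ (fun i : I => w i) ∈ B' I} ≤
        η * π ((fun w : ι → W => hits G w) ⁻¹' {I}) := by
    intro I
    have h2 : (fun w : ι → W => hits G w) ⁻¹' {I} =
        {w : ι → W | hits G w = I ∧ (fun i : I => w i) ∈ (Set.univ : Set (I → W))} := by
      ext; simp
    rw [hval I _ (hB'm I), h2, hval I _ MeasurableSet.univ, Set.inter_univ, ← mul_assoc]
    gcongr
    rw [← cond_mul_eq_inter (MeasurableSet.univ_pi fun _ => hG), ← pi_cond_const R hG hG0]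
    gcongr
    rw [hB', measure_toMeasurable]
    exact hB I
  calc π {w | (fun i : hits G w => w i) ∈ B (hits G w)}
      ≤ π (⋃ I, {w : ι → W | hits G w = I ∧ (fun i : I => w i) ∈ B' I}) := by
        refine measure_mono fun w hw => Set.mem_iUnion.2 ⟨hits G w, rfl, ?_⟩
        exact subset_toMeasurable _ _ hw
    _ ≤ ∑ I, π {w : ι → W | hits G w = I ∧ (fun i : I => w i) ∈ B' I} :=
        measure_iUnion_fintype_le _ _
    _ ≤ ∑ I, η * π ((fun w : ι → W => hits G w) ⁻¹' {I}) := Finset.sum_le_sum fun I _ => hbound I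
    _ = η := by
        rw [← Finset.mul_sum, sum_measure_preimage_singleton _ fun I _ => hhits I]
        simp [hπ]

end Hits

/-! ### Joint law of the marks and the clean data. -/

section Law

/-- The law of a Boolean that is `true` with probability `α`. -/
noncomputable def markLaw (α : ℝ) : Measure Bool :=
  ENNReal.ofReal α • Measure.dirac true + ENNReal.ofReal (1 - α) • Measure.dirac false

lemma isProbabilityMeasure_markLaw {α : ℝ} (h0 : 0 ≤ α) (h1 : α ≤ 1) :
    IsProbabilityMeasure (markLaw α) := by
  constructor
  simp [markLaw, ← ENNReal.ofReal_add h0 (sub_nonneg.2 h1)]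

lemma IsMaliciousCorruption.map_marked_clean {X Ω : Type*} [MeasurableSpace X]
    [MeasurableSpace Ω] {n : ℕ} {μ : Measure Ω} [IsProbabilityMeasure μ]
    {P : Measure (Example X)} [IsProbabilityMeasure P] {α : ℝ} (h0 : 0 ≤ α) (h1 : α ≤ 1)
    {Sc : Ω → Dataset X n} {marked : Ω → Fin n → Bool} {Sp : Ω → Dataset X n}
    (h : IsMaliciousCorruption μ P α Sc marked Sp) :
    μ.map (fun ω i => (marked ω i, Sc ω i)) = Measure.pi fun _ => (markLaw α).prod P := by
  have := isProbabilityMeasure_markLaw h0 h1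
  have hmi : ∀ i, Measurable fun ω => marked ω i := fun i =>
    (measurable_pi_apply i).comp h.measurable_marked
  have hci : ∀ i, Measurable fun ω => Sc ω i := fun i =>
    (measurable_pi_apply i).comp h.measurable_clean
  have hlaw : ∀ i, μ.map (fun ω => marked ω i) = markLaw α := by
    intro i
    have : IsProbabilityMeasure (μ.map fun ω => marked ω i) :=
      Measure.isProbabilityMeasure_map (hmi i).aemeasurable
    have htrue : (μ.map fun ω => marked ω i) {true} = ENNReal.ofReal α := by
      rw [Measure.map_apply (hmi i) (measurableSet_singleton _), ← h.marked_prob i,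
        ofReal_measureReal]
      rfl
    refine Measure.ext_of_singleton fun b => ?_
    cases b
    · have hc : ({false} : Set Bool) = {true}ᶜ := by ext b; cases b <;> simp
      rw [hc, prob_compl_eq_one_sub (measurableSet_singleton _),
        prob_compl_eq_one_sub (measurableSet_singleton _), htrue]
      simp [markLaw]
    · rw [htrue]
      simp [markLaw]
  have hm : μ.map marked = Measure.pi fun _ => markLaw α := by
    have := (iIndepFun_iff_map_fun_eq_pi_map fun i => (hmi i).aemeasurable).1 h.marked_indep
    simpa only [hlaw] using this
  have hc : μ.map Sc = Measure.pi fun _ => P := by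
    have := (iIndepFun_iff_map_fun_eq_pi_map fun i => (hci i).aemeasurable).1 h.clean_indep
    simpa only [h.clean_law] using this
  have hprod := (indepFun_iff_map_prod_eq_prod_map_map h.measurable_marked.aemeasurable
    h.measurable_clean.aemeasurable).1 h.clean_indep_marked.symm
  rw [hm, hc] at hprod
  have he := (measurePreserving_arrowProdEquivProdArrow Bool (Example X) (Fin n)
    (fun _ => markLaw α) (fun _ => P)).symm
  rw [← he.map_eq, ← hprod, Measure.map_map he.measurable
    (h.measurable_marked.prodMk h.measurable_clean)]
  rfl

end Law

/-! ### Near minimisers under uniform approximation. -/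

section NearMinimizers

variable {X : Type*} {n : ℕ}

/-- The criterion depends only on the labels at the sample points, so it takes finitely many values
on `H`. -/
lemma exists_minimizer {H : Set (Classifier X)} (hne : H.Nonempty) {F : Classifier X → ℝ}
    (x : Fin n → X) (hF : ∀ g g' : Classifier X, (∀ i, g (x i) = g' (x i)) → F g = F g') :
    ∃ g ∈ H, ∀ g' ∈ H, F g ≤ F g' := by
  obtain ⟨v, hv, hmin⟩ := Set.exists_min_image ((fun (g : Classifier X) i => g (x i)) '' H)
    (fun v : Fin n → Fin 2 => F (fun y => (Function.extend x v 0) y))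
    (Set.toFinite _) (hne.image _)
  obtain ⟨g, hg, rfl⟩ := hv
  have key : ∀ g : Classifier X,
      F (fun y => Function.extend x (fun i => g (x i)) 0 y) = F g := fun g => hF _ _ fun i => by
    have hfac : Function.FactorsThrough (fun i => g (x i)) x := fun i j hij => by
      simp only [hij]
    exact hfac.extend_apply 0 i
  refine ⟨g, hg, fun g' hg' => ?_⟩
  have := hmin _ (Set.mem_image_of_mem _ hg')
  rwa [key, key] at this

lemma mem_nearMinimizers_of_abs_sub_le {H : Set (Classifier X)} {F f : Classifier X → ℝ} {τ : ℝ}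
    (hFf : ∀ g ∈ H, |F g - f g| ≤ τ) (hmin : ∃ g ∈ H, ∀ g' ∈ H, F g ≤ F g')
    {h₀ : Classifier X} (h₀H : h₀ ∈ H) (hopt : ∀ g ∈ H, f h₀ ≤ f g) :
    h₀ ∈ nearMinimizers H F (2 * τ) := by
  obtain ⟨g, hg, hgmin⟩ := hmin
  refine ⟨h₀H, g, hg, hgmin, ?_⟩
  have h1 := abs_le.1 (hFf h₀ h₀H)
  have h2 := abs_le.1 (hFf g hg)
  have h3 := hopt g hg
  linarith [h1.1, h1.2, h2.1, h2.2]

/-- Chain `f h ≤ F h + τ ≤ F g + 3 * τ ≤ F h₀ + 3 * τ ≤ f h₀ + 4 * τ`; optimality of `h₀` is not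
needed here. -/
lemma sub_le_of_mem_nearMinimizers {H : Set (Classifier X)} {F f : Classifier X → ℝ} {τ : ℝ}
    (hFf : ∀ g ∈ H, |F g - f g| ≤ τ) {h h₀ : Classifier X} (h₀H : h₀ ∈ H)
    (hh : h ∈ nearMinimizers H F (2 * τ)) : f h - f h₀ ≤ 4 * τ := by
  obtain ⟨hH, g, hg, hgmin, hle⟩ := hh
  have h1 := abs_le.1 (hFf h₀ h₀H)
  have h2 := abs_le.1 (hFf h hH)
  have h3 := hgmin h₀ h₀H
  linarith [h1.1, h1.2, h2.1, h2.2]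

lemma empRisk_congr (S : Dataset X n) (g g' : Classifier X)
    (h : ∀ i, g (S i).1 = g' (S i).1) : empRisk S g = empRisk S g' := by
  simp only [empRisk, h]

lemma empOppDev_congr (S : Dataset X n) (g g' : Classifier X)
    (h : ∀ i, g (S i).1 = g' (S i).1) : empOppDev S g = empOppDev S g' := by
  simp only [empOppDev, empTruePosRate, h]

end NearMinimizers

/-! ### Deterministic effect of the corruption. -/

section Corruption

variable {X : Type*} {n : ℕ}

/-- Marked examples. -/
def markedSet (X : Type*) : Set (Bool × Example X) := {w | w.1 = true}

/-- Positive examples of group `a`. -/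
def positiveSet (X : Type*) (a : Fin 2) : Set (Example X) := {z | z.2.1 = a ∧ z.2.2 = 1}

/-- Unmarked positive examples of group `a`. -/
def unmarkedPositiveSet (X : Type*) (a : Fin 2) : Set (Bool × Example X) :=
  {false} ×ˢ positiveSet X a

lemma empRisk_eq_errCount_div (S : Dataset X n) (h : Classifier X) :
    empRisk S h = errCount S h / n := by
  rw [empRisk, errCount, Finset.card_filter, Nat.cast_sum]
  congr 1
  refine Finset.sum_congr rfl fun i _ => ?_
  by_cases hi : h (S i).1 = (S i).2.2 <;> simp [zeroOne, hi]

lemma abs_errCount_sub_le (Sp : Dataset X n) (w : Fin n → Bool × Example X)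
    (hw : ∀ i, (w i).1 = false → Sp i = (w i).2) (h : Classifier X) :
    |errCount Sp h - errCount (fun i => (w i).2) h| ≤ (hits (markedSet X) w).card := by
  rw [errCount, errCount, ← Finset.sum_sub_distrib, card_hits]
  refine (Finset.abs_sum_le_sum_abs _ _).trans (Finset.sum_le_sum fun i _ => ?_)
  by_cases hi : (w i).1 = true
  · have h1 : w i ∈ markedSet X := hi
    have h2 := zeroOne_mem_Icc (h (Sp i).1) (Sp i).2.2
    have h3 := zeroOne_mem_Icc (h (w i).2.1) (w i).2.2.2
    rw [Set.indicator_of_mem h1, abs_le]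
    constructor <;> linarith [h2.1, h2.2, h3.1, h3.2]
  · have h1 : w i ∉ markedSet X := hi
    rw [hw i (by simpa using hi), sub_self, Set.indicator_of_notMem h1, abs_zero]

/-- The marked indices that carry a positive example of group `a` after the corruption. -/
def corruptedPositives (Sp : Dataset X n) (w : Fin n → Bool × Example X) (a : Fin 2) :
    Finset (Fin n) :=
  Finset.univ.filter fun i => (w i).1 = true ∧ (Sp i).2.1 = a ∧ (Sp i).2.2 = 1

/-- A marked index can serve only one group, so the two groups share a single budget. -/
lemma card_corruptedPositives_add_le (Sp : Dataset X n) (w : Fin n → Bool × Example X) :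
    (corruptedPositives Sp w 0).card + (corruptedPositives Sp w 1).card ≤
      (hits (markedSet X) w).card := by
  rw [← Finset.card_union_of_disjoint]
  · refine Finset.card_le_card fun i hi => ?_
    simp only [corruptedPositives, Finset.mem_union, Finset.mem_filter] at hi
    simp only [mem_hits, markedSet, Set.mem_ofPred_eq]
    tauto
  · refine Finset.disjoint_left.2 fun i h0 h1 => ?_
    simp only [corruptedPositives, Finset.mem_filter] at h0 h1
    exact zero_ne_one (h0.2.2.1.symm.trans h1.2.2.1)

/-- The new ratio is a weighted mean of `C₁ / C` and `B₁ / B`, the latter with weight `B / (B + C)`,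
and both lie in `[0, 1]`. -/
lemma abs_div_sub_div_le {B B₁ C C₁ : ℝ} (hC : 0 < C) (hB₁ : 0 ≤ B₁) (hB : B₁ ≤ B) (hC₁ : 0 ≤ C₁)
    (hCC : C₁ ≤ C) : |(C₁ + B₁) / (C + B) - C₁ / C| ≤ B / (B + C) := by
  have hB0 : 0 ≤ B := hB₁.trans hB
  have h1 : (C₁ + B₁) / (C + B) - C₁ / C = (C * B₁ - C₁ * B) / (C * (B + C)) := by
    have : C + B ≠ 0 := by positivity
    have : B + C ≠ 0 := by positivity
    field_simp
    ring
  have h2 : B / (B + C) = (C * B) / (C * (B + C)) := by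
    have : B + C ≠ 0 := by positivity
    field_simp
  rw [h1, h2, abs_div, abs_of_pos (show 0 < C * (B + C) by positivity)]
  refine div_le_div_of_nonneg_right (abs_le.2 ⟨?_, ?_⟩) (by positivity)
  · nlinarith [mul_nonneg hC.le hB₁]
  · nlinarith [mul_nonneg hC₁ hB0]

/-- The positives of group `a` in `Sp` are the unmarked clean ones together with the corrupted ones.
Errors on the former are false negatives, so their frequency is compared with `1 - q`. -/
lemma abs_empTruePosRate_sub_le (Sp : Dataset X n) (w : Fin n → Bool × Example X)
    (hw : ∀ i, (w i).1 = false → Sp i = (w i).2) (h : Classifier X) (a : Fin 2) {q τ : ℝ}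
    (hk : 0 < (hits (unmarkedPositiveSet X a) w).card)
    (hτ : |errCount (fun i : hits (unmarkedPositiveSet X a) w => (w i).2) h -
      (hits (unmarkedPositiveSet X a) w).card * (1 - q)| ≤
        (hits (unmarkedPositiveSet X a) w).card * τ) :
    |empTruePosRate Sp h a - q| ≤
      ((corruptedPositives Sp w a).card : ℝ) /
        ((corruptedPositives Sp w a).card + (hits (unmarkedPositiveSet X a) w).card) + τ := by
  set K := hits (unmarkedPositiveSet X a) w with hK
  set B := corruptedPositives Sp w a with hB
  set K₁ := K.filter fun i => h (Sp i).1 = 1 with hK₁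
  set B₁ := B.filter fun i => h (Sp i).1 = 1 with hB₁
  have hmemK : ∀ i, i ∈ K ↔ (w i).1 = false ∧ (Sp i).2.1 = a ∧ (Sp i).2.2 = 1 := by
    intro i
    rw [hK, mem_hits]
    simp only [unmarkedPositiveSet, positiveSet, Set.mem_prod, Set.mem_singleton_iff,
      Set.mem_ofPred_eq]
    exact and_congr_right fun hi => by rw [hw i hi]
  have hmemB : ∀ i, i ∈ B ↔ (w i).1 = true ∧ (Sp i).2.1 = a ∧ (Sp i).2.2 = 1 := by
    intro i
    simp [hB, corruptedPositives]
  have hdisj : Disjoint K B := Finset.disjoint_left.2 fun i h1 h2 => by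
    have h1 := ((hmemK i).1 h1).1
    have h2 := ((hmemB i).1 h2).1
    simp [h1] at h2
  have hden : (Finset.univ.filter fun i => (Sp i).2.1 = a ∧ (Sp i).2.2 = 1) = K ∪ B := by
    ext i
    rw [Finset.mem_union, hmemK, hmemB]
    cases hwi : (w i).1 <;> simp
  have hnum : (Finset.univ.filter fun i => h (Sp i).1 = 1 ∧ (Sp i).2.1 = a ∧ (Sp i).2.2 = 1) =
      K₁ ∪ B₁ := by
    ext i
    rw [Finset.mem_union, hK₁, hB₁]
    simp only [Finset.mem_filter, hmemK, hmemB, Finset.mem_univ, true_and]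
    cases hwi : (w i).1 <;> simp <;> tauto
  have hdisj₁ : Disjoint K₁ B₁ :=
    hdisj.mono (Finset.filter_subset _ _) (Finset.filter_subset _ _)
  have herr : errCount (fun i : K => (w i).2) h = K.card - K₁.card := by
    rw [errCount, Finset.sum_coe_sort K fun i => zeroOne (h (w i).2.1) (w i).2.2.2, hK₁,
      Finset.card_filter, Finset.card_eq_sum_ones, Nat.cast_sum, Nat.cast_sum,
      ← Finset.sum_sub_distrib]
    refine Finset.sum_congr rfl fun i hi => ?_
    have h1 := (hmemK i).1 hi
    rw [← hw i h1.1, h1.2.2]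
    by_cases h2 : h (Sp i).1 = 1 <;> simp [zeroOne, h2]
  have hkpos : (0 : ℝ) < K.card := by exact_mod_cast hk
  have h1 : |(K₁.card : ℝ) / K.card - q| ≤ τ := by
    rw [herr] at hτ
    have h2 : (K₁.card : ℝ) / K.card - q = -((K.card - K₁.card - K.card * (1 - q)) / K.card) := by
      field_simp
      ring
    rw [h2, abs_neg, abs_div, abs_of_pos hkpos, div_le_iff₀ hkpos]
    linarith
  have h2 : |((K₁.card : ℝ) + B₁.card) / (K.card + B.card) - K₁.card / K.card| ≤
      B.card / (B.card + K.card) :=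
    abs_div_sub_div_le hkpos (Nat.cast_nonneg _)
      (by exact_mod_cast Finset.card_filter_le _ _) (Nat.cast_nonneg _)
      (by exact_mod_cast Finset.card_filter_le _ _)
  have h3 : empTruePosRate Sp h a = ((K₁.card : ℝ) + B₁.card) / (K.card + B.card) := by
    rw [empTruePosRate, hden, hnum, Finset.card_union_of_disjoint hdisj,
      Finset.card_union_of_disjoint hdisj₁, Nat.cast_add, Nat.cast_add]
  rw [h3]
  exact (abs_sub_le _ ((K₁.card : ℝ) / K.card) _).trans (add_le_add h2 h1)

/-- Since `x / (x + c)` is increasing and concave, an even split of the budget is the worst case. -/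
lemma div_add_div_le {B₀ B₁ C₀ C₁ b c : ℝ} (hB₀ : 0 ≤ B₀) (hB₁ : 0 ≤ B₁) (hc : 0 < c)
    (hb : B₀ + B₁ ≤ b) (hC₀ : c ≤ C₀) (hC₁ : c ≤ C₁) :
    B₀ / (B₀ + C₀) + B₁ / (B₁ + C₁) ≤ 2 * b / (b + 2 * c) := by
  have hb0 : 0 ≤ b := by linarith
  calc B₀ / (B₀ + C₀) + B₁ / (B₁ + C₁) ≤ B₀ / (B₀ + c) + B₁ / (B₁ + c) := by gcongr
    _ ≤ 2 * (B₀ + B₁) / (B₀ + B₁ + 2 * c) := by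
        rw [div_add_div _ _ (by positivity) (by positivity),
          div_le_div_iff₀ (by positivity) (by positivity)]
        nlinarith [mul_nonneg hc.le (sq_nonneg (B₀ - B₁)), mul_nonneg hB₀ hB₁]
    _ ≤ 2 * b / (b + 2 * c) := by
        rw [div_le_div_iff₀ (by positivity) (by positivity)]
        nlinarith

end Corruption

/-! ### Arithmetic of the statistical rates. -/

section Rates

lemma mul_log_exp_mul_div_nonneg {n d : ℕ} (hdn : (d : ℝ) / 2 ≤ n) :
    0 ≤ d * Real.log (Real.exp 1 * n / d) := by
  rcases Nat.eq_zero_or_pos d with rfl | hd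
  · simp
  have hd' : (0 : ℝ) < d := by exact_mod_cast hd
  refine mul_nonneg hd'.le (Real.log_nonneg ?_)
  rw [le_div_iff₀ hd']
  have := Real.exp_one_gt_d9
  nlinarith

lemma mul_log_two_mul_exp_mul_div_nonneg {n d : ℕ} (hdn : (d : ℝ) / 2 ≤ n) :
    0 ≤ d * Real.log (2 * Real.exp 1 * n / d) := by
  rcases Nat.eq_zero_or_pos d with rfl | hd
  · simp
  have hd' : (0 : ℝ) < d := by exact_mod_cast hd
  refine mul_nonneg hd'.le (Real.log_nonneg ?_)
  rw [le_div_iff₀ hd']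
  have := Real.exp_one_gt_d9
  nlinarith

lemma pow_eq_exp_mul_log {n d : ℕ} (hn : 0 < n) :
    (Real.exp 1 * (2 * n : ℕ) / d) ^ d = Real.exp (d * Real.log (2 * Real.exp 1 * n / d)) := by
  rcases Nat.eq_zero_or_pos d with rfl | hd
  · simp
  have hd' : (0 : ℝ) < d := by exact_mod_cast hd
  have hn' : (0 : ℝ) < n := by exact_mod_cast hn
  rw [Real.exp_nat_mul, Real.exp_log (by positivity)]
  push_cast
  ring

/-- The growth function is taken at `2 * n` points while `riskRate` has `log (e * n / d)`. For `d >
0`, `x = e * n / d ≥ e / 2 > 1.35` gives `x ^ 3 ≥ 2`, hence `log (2 * x) ≤ 4 * log x`. -/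
lemma mul_log_two_mul_le {n d : ℕ} (hn : 0 < n) (hdn : (d : ℝ) / 2 ≤ n) :
    d * Real.log (2 * Real.exp 1 * n / d) ≤ 4 * (d * Real.log (Real.exp 1 * n / d)) := by
  rcases Nat.eq_zero_or_pos d with rfl | hd
  · simp
  have hd' : (0 : ℝ) < d := by exact_mod_cast hd
  have hn' : (0 : ℝ) < n := by exact_mod_cast hn
  set x := Real.exp 1 * n / d with hx
  have hx0 : 0 < x := by positivity
  have hx1 : 1.35 ≤ x := by
    rw [hx, le_div_iff₀ hd']
    have := Real.exp_one_gt_d9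
    nlinarith
  have h2 : 2 * Real.exp 1 * n / d = 2 * x := by rw [hx]; ring
  have h3 : Real.log (2 * x) ≤ 4 * Real.log x := by
    rw [← Real.log_rpow hx0]
    refine Real.log_le_log (by positivity) ?_
    norm_cast
    have : (1.35 : ℝ) ^ 3 ≤ x ^ 3 := by gcongr
    nlinarith
  rw [h2]
  nlinarith

lemma one_le_log_div {c δ : ℝ} (hc : 16 ≤ c) (hδ0 : 0 < δ) (hδ1 : δ < 1) :
    1 ≤ Real.log (c / δ) := by
  rw [Real.le_log_iff_exp_le (by positivity), le_div_iff₀ hδ0]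
  have := Real.exp_one_lt_d9
  nlinarith

lemma sq_riskRate_mul {n d : ℕ} {δ : ℝ} (hn : 0 < n) (hdn : (d : ℝ) / 2 ≤ n) (hδ0 : 0 < δ)
    (hδ1 : δ < 1) : n * riskRate n d δ ^ 2 =
      8 * (d * Real.log (Real.exp 1 * n / d)) + 2 * Real.log (16 / δ) := by
  have hn' : (0 : ℝ) < n := by exact_mod_cast hn
  have h1 := mul_log_exp_mul_div_nonneg hdn
  have h2 := one_le_log_div le_rfl hδ0 hδ1
  rw [riskRate, Real.sq_sqrt]
  · field_simp
  · refine div_nonneg ?_ hn'.le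
    linarith

lemma sq_oppRate_mul {n d : ℕ} {δ α p : ℝ} (hn : 0 < n) (hdn : (d : ℝ) / 2 ≤ n) (hδ0 : 0 < δ)
    (hδ1 : δ < 1) (hα : α < 1) (hp : 0 < p) : (1 - α) * p * n * oppRate n d δ α p ^ 2 =
      2 * (d * Real.log (2 * Real.exp 1 * n / d)) + 2 * Real.log (96 / δ) := by
  have hn' : (0 : ℝ) < n := by exact_mod_cast hn
  have hα' : 0 < 1 - α := sub_pos.2 hα
  have h1 := mul_log_two_mul_exp_mul_div_nonneg hdn
  have h2 := one_le_log_div (c := 96) (by norm_num) hδ0 hδ1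
  rw [oppRate, Real.sq_sqrt]
  · field_simp
  · refine div_nonneg ?_ (by positivity)
    linarith

lemma exp_neg_log_div {c δ : ℝ} (hc : 0 < c) (hδ0 : 0 < δ) :
    Real.exp (-Real.log (c / δ)) = δ / c := by
  rw [Real.exp_neg, Real.exp_log (by positivity), inv_div]

end Rates

/-! ### Uniform convergence for the risk and the true positive rates. -/

section Deviations

variable {X : Type*} [MeasurableSpace X]

/-- Uniform convergence of the risk. -/
lemma measure_risk_deviation_le {n : ℕ} {H : Set (Classifier X)} (hH : MeasurableClass H)
    {d : ℕ} (hd : vcDim H = d) (hn : 0 < n) (hdn : (d : ℝ) / 2 ≤ n) {δ : ℝ} (hδ0 : 0 < δ)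
    (hδ1 : δ < 1) (P : Measure (Example X)) [IsProbabilityMeasure P] :
    (Measure.pi fun _ : Fin n => P)
        {z | ∃ h ∈ H, 2 * (n * riskRate n d δ) < |errCount z h - n * risk P h|} ≤
      ENNReal.ofReal (δ / 4) := by
  have : Nonempty (Fin n) := Fin.pos_iff_nonempty.1 hn
  have hn' : (0 : ℝ) < n := by exact_mod_cast hn
  have hsq := sq_riskRate_mul hn hdn hδ0 hδ1
  have h1 := mul_log_exp_mul_div_nonneg hdn
  have h2 := one_le_log_div le_rfl hδ0 hδ1
  have hr : 0 < riskRate n d δ := by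
    refine lt_of_le_of_ne (Real.sqrt_nonneg _) fun h0 => ?_
    rw [← h0] at hsq
    norm_num at hsq
    linarith
  have hd2 : d ≤ 2 * n := by
    have : (d : ℝ) ≤ 2 * n := by linarith
    exact_mod_cast this
  have hvc := measure_exists_errCount_le (ι := Fin n) (m := 2 * n) hH hd hd2 (by simp) P
    (t := n * riskRate n d δ) (by positivity) (by
      rw [Fintype.card_fin]
      nlinarith)
  rw [Fintype.card_fin] at hvc
  refine hvc.trans (ENNReal.ofReal_le_ofReal ?_)
  have hexp : (n * riskRate n d δ) ^ 2 / (2 * n) =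
      4 * (d * Real.log (Real.exp 1 * n / d)) + Real.log (16 / δ) := by
    rw [mul_pow, show (n : ℝ) ^ 2 * riskRate n d δ ^ 2 / (2 * n) = n * riskRate n d δ ^ 2 / 2 by
      field_simp, hsq]
    ring
  rw [hexp, pow_eq_exp_mul_log hn, mul_assoc, ← Real.exp_add]
  calc 4 * Real.exp (d * Real.log (2 * Real.exp 1 * n / d) +
        -(4 * (d * Real.log (Real.exp 1 * n / d)) + Real.log (16 / δ)))
      ≤ 4 * Real.exp (-Real.log (16 / δ)) := by
        gcongr
        linarith [mul_log_two_mul_le hn hdn]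
    _ = δ / 4 := by
        rw [exp_neg_log_div (by norm_num) hδ0]
        ring

/-- Uniform convergence of the risk on `k` examples, at the precision needed for the conditional
laws. -/
lemma measure_conditional_deviation_le {ι : Type*} [Fintype ι] {n : ℕ} {H : Set (Classifier X)}
    (hH : MeasurableClass H) {d : ℕ} (hd : vcDim H = d) (hn : 0 < n) (hdn : (d : ℝ) / 2 ≤ n)
    {δ α p : ℝ} (hδ0 : 0 < δ) (hδ1 : δ < 1) (hα : α < 1) (hp : 0 < p)
    (hι : Fintype.card ι ≤ n) (hι' : (1 - α) * p * n / 2 ≤ Fintype.card ι)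
    (Q : Measure (Example X)) [IsProbabilityMeasure Q] :
    (Measure.pi fun _ : ι => Q)
        {z | ∃ h ∈ H, 2 * (4 * Fintype.card ι * oppRate n d δ α p) <
          |errCount z h - Fintype.card ι * risk Q h|} ≤
      ENNReal.ofReal (δ / 24) := by
  have hn' : (0 : ℝ) < n := by exact_mod_cast hn
  have hα' : 0 < 1 - α := sub_pos.2 hα
  have hk : (0 : ℝ) < Fintype.card ι := lt_of_lt_of_le (by positivity) hι'
  have : Nonempty ι := Fintype.card_pos_iff.1 (by exact_mod_cast hk)
  have hsq := sq_oppRate_mul hn hdn hδ0 hδ1 hα hp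
  have h1 := mul_log_two_mul_exp_mul_div_nonneg hdn
  have h2 := one_le_log_div (c := 96) (by norm_num) hδ0 hδ1
  set s := oppRate n d δ α p with hs
  have hr : 0 < s := by
    refine lt_of_le_of_ne (Real.sqrt_nonneg _) fun h0 => ?_
    rw [show s = 0 from h0.symm] at hsq
    norm_num at hsq
    linarith
  -- The lower bound on the sample size loses a factor `2`, absorbed by the factor `2` in the
  -- numerator of `oppRate ^ 2`.
  have hks : d * Real.log (2 * Real.exp 1 * n / d) + Real.log (96 / δ) ≤
      Fintype.card ι * s ^ 2 := by
    have := mul_le_mul_of_nonneg_right hι' (sq_nonneg s)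
    linarith
  have hd2 : d ≤ 2 * n := by
    have : (d : ℝ) ≤ 2 * n := by linarith
    exact_mod_cast this
  -- The growth function is evaluated at `2 * n` whatever the size of `ι`, so the bound is uniform
  -- over the possible index sets.
  have hvc := measure_exists_errCount_le (ι := ι) (m := 2 * n) hH hd hd2 (by omega) Q
    (t := 4 * Fintype.card ι * s) (by positivity) (by nlinarith)
  refine hvc.trans (ENNReal.ofReal_le_ofReal ?_)
  have hexp : (4 * Fintype.card ι * s) ^ 2 / (2 * Fintype.card ι) =
      8 * (Fintype.card ι * s ^ 2) := by
    field_simp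
    ring
  rw [hexp, pow_eq_exp_mul_log hn, mul_assoc, ← Real.exp_add]
  calc 4 * Real.exp (d * Real.log (2 * Real.exp 1 * n / d) + -(8 * (Fintype.card ι * s ^ 2)))
      ≤ 4 * Real.exp (-Real.log (96 / δ)) := by
        gcongr
        linarith
    _ = δ / 24 := by
        rw [exp_neg_log_div (by norm_num) hδ0]
        ring

lemma measurableSet_positiveSet (a : Fin 2) : MeasurableSet (positiveSet X a) :=
  (measurableSet_eq_fun (by fun_prop) measurable_const).inter
    (measurableSet_eq_fun (by fun_prop) measurable_const)

lemma measurableSet_unmarkedPositiveSet (a : Fin 2) :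
    MeasurableSet (unmarkedPositiveSet X a) :=
  (measurableSet_singleton _).prod (measurableSet_positiveSet a)

lemma measurableSet_markedSet : MeasurableSet (markedSet X) :=
  measurable_fst (measurableSet_singleton true)

lemma measureReal_markedSet {α : ℝ} (hα : 0 ≤ α) (P : Measure (Example X))
    [IsProbabilityMeasure P] : ((markLaw α).prod P).real (markedSet X) = α := by
  have h : markedSet X = {true} ×ˢ (Set.univ : Set (Example X)) := by
    ext
    simp [markedSet]
  rw [h, measureReal_def, Measure.prod_prod]
  simp [markLaw, hα]

lemma measureReal_unmarkedPositiveSet {α : ℝ} (hα : α ≤ 1) (P : Measure (Example X))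
    [IsProbabilityMeasure P] (a : Fin 2) :
    ((markLaw α).prod P).real (unmarkedPositiveSet X a) = (1 - α) * posRate P a := by
  rw [unmarkedPositiveSet, measureReal_def, Measure.prod_prod, ENNReal.toReal_mul]
  congr 1
  simp [markLaw, hα]

/-- The mark is independent of the example, so conditioning on being unmarked does not bias the
positives. -/
lemma measurePreserving_snd_cond {α : ℝ} (hα : α < 1) (P : Measure (Example X))
    [IsProbabilityMeasure P] (a : Fin 2) :
    MeasurePreserving Prod.snd (((markLaw α).prod P)[|unmarkedPositiveSet X a])
      (P[|positiveSet X a]) := by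
  refine ⟨measurable_snd, Measure.ext fun s hs => ?_⟩
  have hf : (markLaw α) {false} = ENNReal.ofReal (1 - α) := by simp [markLaw]
  have hf0 : ENNReal.ofReal (1 - α) ≠ 0 := by simpa using hα
  have hinter : unmarkedPositiveSet X a ∩ Prod.snd ⁻¹' s = {false} ×ˢ (positiveSet X a ∩ s) := by
    ext
    simp [unmarkedPositiveSet, and_assoc]
  rw [Measure.map_apply measurable_snd hs, cond_apply (measurableSet_unmarkedPositiveSet a),
    cond_apply (measurableSet_positiveSet a), hinter, unmarkedPositiveSet, Measure.prod_prod,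
    Measure.prod_prod, hf, ENNReal.mul_inv (Or.inl hf0) (Or.inl ENNReal.ofReal_ne_top),
    mul_mul_mul_comm, ENNReal.inv_mul_cancel hf0 ENNReal.ofReal_ne_top, one_mul]

/-- All labels are `1` under the conditional law, so an error is a false negative; this turns a
bound on risks into one on true positive rates. -/
lemma risk_cond_positiveSet {h : Classifier X} (hh : Measurable h) (P : Measure (Example X))
    [IsProbabilityMeasure P] {a : Fin 2} (ha : P (positiveSet X a) ≠ 0) :
    risk (P[|positiveSet X a]) h = 1 - truePosRate P h a := by
  have : IsProbabilityMeasure (P[|positiveSet X a]) := cond_isProbabilityMeasure ha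
  have hm : MeasurableSet {z : Example X | h z.1 = 1} :=
    measurableSet_eq_fun (hh.comp measurable_fst) measurable_const
  have h1 : truePosRate P h a = (P[|positiveSet X a]).real {z | h z.1 = 1} := rfl
  rw [h1, ← probReal_compl_eq_one_sub hm, risk]
  refine measureReal_congr ?_
  filter_upwards [ae_cond_mem (measurableSet_positiveSet a)] with z hz
  have h2 : z.2.2 = 1 := hz.2
  exact propext (by change h z.1 ≠ z.2.2 ↔ ¬ (h z.1 = 1); rw [h2])

/-- Uniform convergence of the true positive rate in group `a` on the unmarked data. -/
lemma measure_truePosRate_deviation_le {n : ℕ} {H : Set (Classifier X)}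
    (hH : MeasurableClass H) {d : ℕ} (hd : vcDim H = d) (hn : 0 < n) (hdn : (d : ℝ) / 2 ≤ n)
    {δ α p : ℝ} (hδ0 : 0 < δ) (hδ1 : δ < 1) (hα0 : 0 ≤ α) (hα : α < 1) (hp : 0 < p)
    (P : Measure (Example X)) [IsProbabilityMeasure P] {a : Fin 2}
    (ha : P (positiveSet X a) ≠ 0) :
    (Measure.pi fun _ : Fin n => (markLaw α).prod P)
        {w | (1 - α) * p * n / 2 ≤ (hits (unmarkedPositiveSet X a) w).card ∧ ∃ h ∈ H,
          2 * (4 * (hits (unmarkedPositiveSet X a) w).card * oppRate n d δ α p) <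
          |errCount (fun i : hits (unmarkedPositiveSet X a) w => (w i).2) h -
            (hits (unmarkedPositiveSet X a) w).card * (1 - truePosRate P h a)|} ≤
      ENNReal.ofReal (δ / 24) := by
  have := isProbabilityMeasure_markLaw hα0 hα.le
  have hP : IsProbabilityMeasure (P[|positiveSet X a]) := cond_isProbabilityMeasure ha
  have hR : ((markLaw α).prod P) (unmarkedPositiveSet X a) ≠ 0 := by
    rw [unmarkedPositiveSet, Measure.prod_prod]
    refine mul_ne_zero ?_ ha
    simpa [markLaw] using hα
  have hRp : IsProbabilityMeasure (((markLaw α).prod P)[|unmarkedPositiveSet X a]) :=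
    cond_isProbabilityMeasure hR
  -- The size condition is part of `B`, so index sets too small for the VC bound contribute the
  -- empty event.
  set B : ∀ I : Finset (Fin n), Set (I → Bool × Example X) := fun I =>
    {u | (1 - α) * p * n / 2 ≤ I.card ∧ ∃ h ∈ H, 2 * (4 * I.card * oppRate n d δ α p) <
      |errCount (fun i => (u i).2) h - I.card * (1 - truePosRate P h a)|} with hB
  refine measure_restrict_hits_mem_le _ (measurableSet_unmarkedPositiveSet a) hR B fun I => ?_
  by_cases hI : (1 - α) * p * n / 2 ≤ I.card
  · have hmp := measurePreserving_pi (fun _ : I => ((markLaw α).prod P)[|unmarkedPositiveSet X a])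
      (fun _ : I => P[|positiveSet X a]) fun _ => measurePreserving_snd_cond hα P a
    have hdev := measure_conditional_deviation_le (ι := I) hH hd hn hdn hδ0 hδ1 hα hp
      (by simpa using Finset.card_le_univ I) (by simpa using hI) (P[|positiveSet X a])
    rw [Fintype.card_coe] at hdev
    refine le_trans ?_ hdev
    rw [← hmp.map_eq]
    refine le_trans (measure_mono ?_) (Measure.le_map_apply hmp.measurable.aemeasurable _)
    rintro u ⟨-, h, hh, hlt⟩
    refine ⟨h, hh, ?_⟩
    rwa [risk_cond_positiveSet (hH.measurable h hh) P ha]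
  · have : B I = ∅ := Set.eq_empty_of_forall_notMem fun u hu => hI hu.1
    rw [this, measure_empty]
    exact zero_le

end Deviations

/-! ### The good event and the final bound. -/

section Main

variable {X : Type*} [MeasurableSpace X]

/-- The samples of marked or unmarked clean data for which one of the concentration estimates
fails. -/
def badSet (H : Set (Classifier X)) (P : Measure (Example X)) (n d : ℕ) (δ α : ℝ) :
    Set (Fin n → Bool × Example X) :=
  {w | 3 / 2 * (n * α) ≤ (hits (markedSet X) w).card} ∪
  (⋃ a, {w | (hits (unmarkedPositiveSet X a) w).card ≤ n * ((1 - α) * posRate P a) / 2}) ∪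
  {w | ∃ h ∈ H, 2 * (n * riskRate n d δ) <
    |errCount (fun i => (w i).2) h - n * risk P h|} ∪
  ⋃ a, {w | (1 - α) * posRate P 0 * n / 2 ≤ (hits (unmarkedPositiveSet X a) w).card ∧ ∃ h ∈ H,
    2 * (4 * (hits (unmarkedPositiveSet X a) w).card * oppRate n d δ α (posRate P 0)) <
    |errCount (fun i : hits (unmarkedPositiveSet X a) w => (w i).2) h -
      (hits (unmarkedPositiveSet X a) w).card * (1 - truePosRate P h a)|}

lemma abs_empRisk_sub_le {H : Set (Classifier X)} {P : Measure (Example X)} {n d : ℕ} {δ α : ℝ}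
    (hn : 0 < n) {w : Fin n → Bool × Example X} (hgood : w ∉ badSet H P n d δ α)
    {Sp : Dataset X n} (hw : ∀ i, (w i).1 = false → Sp i = (w i).2) {h : Classifier X}
    (hh : h ∈ H) : |empRisk Sp h - risk P h| ≤ 3 / 2 * α + 2 * riskRate n d δ := by
  have hn' : (0 : ℝ) < n := by exact_mod_cast hn
  simp only [badSet, Set.mem_union, not_or, Set.mem_ofPred_eq, not_le] at hgood
  have h1 := hgood.1.1.1
  have h2 := hgood.1.2
  push Not at h2
  have h3 := h2 h hh
  have h4 := abs_errCount_sub_le Sp w hw h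
  have h5 : empRisk Sp h - risk P h = (errCount Sp h - n * risk P h) / n := by
    rw [empRisk_eq_errCount_div]
    field_simp
  rw [h5, abs_div, abs_of_pos hn', div_le_iff₀ hn']
  have h6 := abs_sub_le (errCount Sp h) (errCount (fun i => (w i).2) h) (n * risk P h)
  linarith

lemma abs_empOppDev_sub_le {H : Set (Classifier X)} {P : Measure (Example X)} {n d : ℕ}
    {δ α : ℝ} (hn : 0 < n) (hα0 : 0 < α) (hα : α < 1 / 2) (hP0 : 0 < posRate P 0)
    (hP01 : posRate P 0 ≤ posRate P 1) {w : Fin n → Bool × Example X}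
    (hgood : w ∉ badSet H P n d δ α) {Sp : Dataset X n}
    (hw : ∀ i, (w i).1 = false → Sp i = (w i).2) {h : Classifier X} (hh : h ∈ H) :
    |empOppDev Sp h - oppDev P h| ≤
      deltaOpp α (posRate P 0) + 16 * oppRate n d δ α (posRate P 0) := by
  have hn' : (0 : ℝ) < n := by exact_mod_cast hn
  simp only [badSet, Set.mem_union, not_or, Set.mem_iUnion, not_exists, Set.mem_ofPred_eq,
    not_le, not_and, not_lt] at hgood
  obtain ⟨⟨⟨hmark, hcard⟩, -⟩, hdev⟩ := hgood
  set p := posRate P 0 with hp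
  have hle : ∀ a, p ≤ posRate P a := by
    intro a
    fin_cases a
    · exact le_rfl
    · exact hP01
  have hc : ∀ a, (1 - α) * p * n / 2 ≤ (hits (unmarkedPositiveSet X a) w).card := fun a => by
    refine le_trans ?_ (hcard a).le
    have := mul_le_mul_of_nonneg_left (hle a) (show 0 ≤ n * (1 - α) by nlinarith)
    linarith
  -- Here `α < 1 / 2` is used as `1 - α ≥ 1 / 2`.
  have hc' : ∀ a, p * n / 4 ≤ (hits (unmarkedPositiveSet X a) w).card := fun a => by
    refine le_trans ?_ (hc a)
    nlinarith [mul_pos hP0 hn']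
  have hpos : 0 < p * n / 4 := by positivity
  have htpr : ∀ a, |empTruePosRate Sp h a - truePosRate P h a| ≤
      ((corruptedPositives Sp w a).card : ℝ) /
        ((corruptedPositives Sp w a).card + (hits (unmarkedPositiveSet X a) w).card) +
        8 * oppRate n d δ α p := fun a => by
    refine abs_empTruePosRate_sub_le Sp w hw h a ?_ ?_
    · exact_mod_cast hpos.trans_le (hc' a)
    · exact (hdev a (hc a) h hh).trans_eq (by ring)
  have hb : ((corruptedPositives Sp w 0).card : ℝ) + (corruptedPositives Sp w 1).card ≤
      3 / 2 * (n * α) := by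
    refine le_trans ?_ hmark.le
    exact_mod_cast card_corruptedPositives_add_le Sp w
  have hsum := div_add_div_le (Nat.cast_nonneg _) (Nat.cast_nonneg _) hpos hb (hc' 0) (hc' 1)
  -- The constant in `deltaOpp` comes from the budget `3 / 2 * n * α` and the floor `p * n / 4` on
  -- each group.
  have hdelta : 2 * (3 / 2 * (n * α)) / (3 / 2 * (n * α) + 2 * (p * n / 4)) = deltaOpp α p := by
    rw [deltaOpp, div_eq_div_iff (by positivity) (by positivity)]
    ring
  rw [hdelta] at hsum
  calc |empOppDev Sp h - oppDev P h|
      ≤ |(empTruePosRate Sp h 0 - empTruePosRate Sp h 1) -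
          (truePosRate P h 0 - truePosRate P h 1)| := abs_abs_sub_abs_le_abs_sub _ _
    _ = |(empTruePosRate Sp h 0 - truePosRate P h 0) -
          (empTruePosRate Sp h 1 - truePosRate P h 1)| := by congr 1; ring
    _ ≤ |empTruePosRate Sp h 0 - truePosRate P h 0| +
          |empTruePosRate Sp h 1 - truePosRate P h 1| := abs_sub _ _
    _ ≤ _ := by linarith [htpr 0, htpr 1]

lemma objectives_sub_le_of_notMem_badSet {H : Set (Classifier X)} {P : Measure (Example X)}
    {n d : ℕ} {δ α : ℝ} (hn : 0 < n) (hα0 : 0 < α) (hα : α < 1 / 2) (hP0 : 0 < posRate P 0)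
    (hP01 : posRate P 0 ≤ posRate P 1) {h₀ : Classifier X} (h₀H : h₀ ∈ H)
    (hopt : ∀ h ∈ H, objectives P h₀ ≤ objectives P h) {L : Dataset X n → Classifier X}
    (hL : IsComponentwiseLearner H d δ α (posRate P 0) L) {w : Fin n → Bool × Example X}
    (hgood : w ∉ badSet H P n d δ α) {Sp : Dataset X n}
    (hw : ∀ i, (w i).1 = false → Sp i = (w i).2) :
    objectives P (L Sp) - objectives P h₀ ≤
      (6 * α + 8 * riskRate n d δ,
        4 * deltaOpp α (posRate P 0) + 64 * oppRate n d δ α (posRate P 0)) := by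
  have hrisk : ∀ g ∈ H, |empRisk Sp g - risk P g| ≤ 3 / 2 * α + 2 * riskRate n d δ :=
    fun g hg => abs_empRisk_sub_le hn hgood hw hg
  have hopp : ∀ g ∈ H, |empOppDev Sp g - oppDev P g| ≤
      deltaOpp α (posRate P 0) + 16 * oppRate n d δ α (posRate P 0) :=
    fun g hg => abs_empOppDev_sub_le hn hα0 hα hP0 hP01 hgood hw hg
  have hgoodSet : goodSet H d δ α (posRate P 0) Sp =
      nearMinimizers H (empRisk Sp) (2 * (3 / 2 * α + 2 * riskRate n d δ)) ∩
        nearMinimizers H (empOppDev Sp)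
          (2 * (deltaOpp α (posRate P 0) + 16 * oppRate n d δ α (posRate P 0))) := by
    rw [goodSet]
    congr 2 <;> ring
  have hmem := hL.mem_goodSet Sp ⟨h₀, by
    rw [hgoodSet]
    exact ⟨mem_nearMinimizers_of_abs_sub_le hrisk
        (exists_minimizer ⟨h₀, h₀H⟩ (fun i => (Sp i).1) (empRisk_congr Sp)) h₀H
        fun g hg => (hopt g hg).1,
      mem_nearMinimizers_of_abs_sub_le hopp
        (exists_minimizer ⟨h₀, h₀H⟩ (fun i => (Sp i).1) (empOppDev_congr Sp)) h₀H
        fun g hg => (hopt g hg).2⟩⟩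
  rw [hgoodSet] at hmem
  refine ⟨?_, ?_⟩
  · refine (sub_le_of_mem_nearMinimizers hrisk h₀H hmem.1).trans_eq ?_
    ring
  · refine (sub_le_of_mem_nearMinimizers hopp h₀H hmem.2).trans_eq ?_
    ring

/-- The failure probabilities are `δ / 12` for the marks, `2 * δ / 16` for the group sizes, `δ / 4`
for the risk and `2 * δ / 24` for the rates: `13 * δ / 24` in total. -/
lemma measure_badSet_le {H : Set (Classifier X)} (hH : MeasurableClass H) {d : ℕ}
    (hd : vcDim H = d) (P : Measure (Example X)) [IsProbabilityMeasure P]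
    (hP0 : 0 < posRate P 0) (hP01 : posRate P 0 ≤ posRate P 1) {α δ : ℝ} (hα0 : 0 < α)
    (hα : α < 1) (hδ0 : 0 < δ) (hδ1 : δ < 1) {n : ℕ} (hn : 0 < n)
    (hn₁ : 8 * Real.log (16 / δ) / ((1 - α) * posRate P 0) ≤ n)
    (hn₂ : 12 * Real.log (12 / δ) / α ≤ n) (hdn : (d : ℝ) / 2 ≤ n) :
    (Measure.pi fun _ : Fin n => (markLaw α).prod P) (badSet H P n d δ α) ≤
      ENNReal.ofReal δ := by
  have := isProbabilityMeasure_markLaw hα0.le hα.le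
  have hα' : 0 < 1 - α := sub_pos.2 hα
  have hn' : (0 : ℝ) < n := by exact_mod_cast hn
  set π := Measure.pi fun _ : Fin n => (markLaw α).prod P with hπ
  have hle : ∀ a, posRate P 0 ≤ posRate P a := by
    intro a
    fin_cases a
    · exact le_rfl
    · exact hP01
  have hmark : π {w | 3 / 2 * (n * α) ≤ (hits (markedSet X) w).card} ≤
      ENNReal.ofReal (δ / 12) := by
    have h := measure_card_hits_ge_le (ι := Fin n) ((markLaw α).prod P) measurableSet_markedSet
    rw [measureReal_markedSet hα0.le, Fintype.card_fin] at h
    rw [← ofReal_measureReal]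
    refine ENNReal.ofReal_le_ofReal (h.trans ?_)
    rw [← exp_neg_log_div (c := 12) (by norm_num) hδ0]
    rw [div_le_iff₀ hα0] at hn₂
    gcongr
    linarith
  have hcard : ∀ a, π {w | (hits (unmarkedPositiveSet X a) w).card ≤
      n * ((1 - α) * posRate P a) / 2} ≤ ENNReal.ofReal (δ / 16) := fun a => by
    have h := measure_card_hits_le_le (ι := Fin n) ((markLaw α).prod P)
      (measurableSet_unmarkedPositiveSet a)
    rw [measureReal_unmarkedPositiveSet hα.le, Fintype.card_fin] at h
    rw [← ofReal_measureReal]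
    refine ENNReal.ofReal_le_ofReal (h.trans ?_)
    rw [← exp_neg_log_div (c := 16) (by norm_num) hδ0]
    rw [div_le_iff₀ (by positivity)] at hn₁
    have := mul_le_mul_of_nonneg_left (hle a) (show 0 ≤ n * (1 - α) by positivity)
    gcongr
    linarith
  have hrisk : π {w | ∃ h ∈ H, 2 * (n * riskRate n d δ) <
      |errCount (fun i => (w i).2) h - n * risk P h|} ≤ ENNReal.ofReal (δ / 4) := by
    have hmp := measurePreserving_pi (fun _ : Fin n => (markLaw α).prod P) (fun _ : Fin n => P)
      fun _ => measurePreserving_snd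
    refine le_trans ?_ (measure_risk_deviation_le hH hd hn hdn hδ0 hδ1 P)
    rw [← hmp.map_eq]
    exact Measure.le_map_apply hmp.measurable.aemeasurable _
  have hopp : ∀ a, π {w | (1 - α) * posRate P 0 * n / 2 ≤
      (hits (unmarkedPositiveSet X a) w).card ∧ ∃ h ∈ H,
      2 * (4 * (hits (unmarkedPositiveSet X a) w).card * oppRate n d δ α (posRate P 0)) <
      |errCount (fun i : hits (unmarkedPositiveSet X a) w => (w i).2) h -
        (hits (unmarkedPositiveSet X a) w).card * (1 - truePosRate P h a)|} ≤
      ENNReal.ofReal (δ / 24) := fun a => by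
    refine measure_truePosRate_deviation_le hH hd hn hdn hδ0 hδ1 hα0.le hα hP0 P fun h0 => ?_
    have h1 : posRate P a = 0 := by
      rw [posRate, measureReal_def]
      exact (congrArg ENNReal.toReal h0).trans ENNReal.toReal_zero
    have := hle a
    linarith
  have hunion : ∀ (A : Fin 2 → Set (Fin n → Bool × Example X)) (η : ℝ), 0 ≤ η →
      (∀ a, π (A a) ≤ ENNReal.ofReal η) → π (⋃ a, A a) ≤ ENNReal.ofReal (2 * η) := by
    intro A η hη hA
    refine (measure_iUnion_fintype_le _ _).trans ?_
    rw [Fin.sum_univ_two, two_mul, ENNReal.ofReal_add hη hη]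
    exact add_le_add (hA 0) (hA 1)
  refine (measure_union_le _ _).trans ((add_le_add ((measure_union_le _ _).trans (add_le_add
    ((measure_union_le _ _).trans (add_le_add hmark (hunion _ _ (by positivity) hcard))) hrisk))
    (hunion _ _ (by positivity) hopp)).trans ?_)
  rw [← ENNReal.ofReal_add (by positivity) (by positivity),
    ← ENNReal.ofReal_add (by positivity) (by positivity),
    ← ENNReal.ofReal_add (by positivity) (by positivity)]
  refine ENNReal.ofReal_le_ofReal ?_
  linarith

end Main

end FairPAC

theorem theorem8 {X Ω : Type*} [MeasurableSpace X] [MeasurableSpace Ω]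
    -- hypothesis class of finite VC dimension `d`
    (H : Set (Classifier X)) (hH : MeasurableClass H) (d : ℕ) (hd : vcDim H = d)
    -- clean distribution, with the positives of group `0` the rarer ones
    (P : Measure (Example X)) [IsProbabilityMeasure P]
    (hP0 : 0 < posRate P 0) (hP01 : posRate P 0 ≤ posRate P 1)
    -- a hypothesis that is optimal in both objectives
    (hstar : Classifier X) (hstar_mem : hstar ∈ H)
    (hstar_opt : ∀ h ∈ H, objectives P hstar ≤ objectives P h)
    (α : ℝ) (hα0 : 0 < α) (hα : α < 1 / 2) (δ : ℝ) (hδ0 : 0 < δ) (hδ1 : δ < 1)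
    (n : ℕ)
    (hn : max (max (8 * Real.log (16 / δ) / ((1 - α) * posRate P 0))
      (12 * Real.log (12 / δ) / α)) ((d : ℝ) / 2) ≤ n)
    (L : Dataset X n → Classifier X) (hL : IsComponentwiseLearner H d δ α (posRate P 0) L)
    -- any malicious adversary of power `α`
    (μ : Measure Ω) [IsProbabilityMeasure μ] (Sc : Ω → Dataset X n)
    (marked : Ω → Fin n → Bool) (Sp : Ω → Dataset X n)
    (hadv : IsMaliciousCorruption μ P α Sc marked Sp) :
    ∃ E : Set Ω, MeasurableSet E ∧ 1 - δ ≤ μ.real E ∧ ∀ ω ∈ E,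
      objectives P (L (Sp ω)) - objectives P hstar ≤
        (6 * α + 8 * riskRate n d δ,
          4 * deltaOpp α (posRate P 0) + 64 * oppRate n d δ α (posRate P 0)) := by
  have hn₁ := (le_max_left _ _).trans ((le_max_left _ _).trans hn)
  have hn₂ := (le_max_right _ _).trans ((le_max_left _ _).trans hn)
  have hdn := (le_max_right _ _).trans hn
  have hn0 : 0 < n := by
    have h1 : 0 < Real.log (12 / δ) := by
      refine Real.log_pos ?_
      rw [lt_div_iff₀ hδ0]
      linarith
    have h2 : (0 : ℝ) < n := lt_of_lt_of_le (by positivity) hn₂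
    exact_mod_cast h2
  set Φ : Ω → Fin n → Bool × Example X := fun ω i => (marked ω i, Sc ω i) with hΦ
  have hΦm : Measurable Φ := measurable_pi_lambda _ fun i =>
    ((measurable_pi_apply i).comp hadv.measurable_marked).prodMk
      ((measurable_pi_apply i).comp hadv.measurable_clean)
  set N : Set Ω := {ω | ¬ ∀ i, marked ω i = false → Sp ω i = Sc ω i} with hN
  have hN0 : μ N = 0 := ae_iff.1 hadv.unmarked_eq
  have hbad : μ (Φ ⁻¹' badSet H P n d δ α ∪ N) ≤ ENNReal.ofReal δ := by
    refine (measure_union_le _ _).trans ?_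
    rw [hN0, add_zero]
    -- The bad set need not be measurable; the inequality for image measures holds for arbitrary
    -- sets in this direction.
    refine (Measure.le_map_apply hΦm.aemeasurable _).trans ?_
    rw [hΦ, hadv.map_marked_clean hα0.le (by linarith)]
    exact measure_badSet_le hH hd P hP0 hP01 hα0 (by linarith) hδ0 hδ1 hn0 hn₁ hn₂ hdn
  -- Neither `Sp` nor the learner is assumed measurable, so the event is the complement of a
  -- measurable hull of the failures.
  set T := toMeasurable μ (Φ ⁻¹' badSet H P n d δ α ∪ N) with hT
  have hTm : MeasurableSet T := measurableSet_toMeasurable _ _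
  refine ⟨Tᶜ, hTm.compl, ?_, fun ω hω => ?_⟩
  · rw [probReal_compl_eq_one_sub hTm]
    have h1 : μ.real T ≤ δ := by
      rw [measureReal_def, hT, measure_toMeasurable]
      exact ENNReal.toReal_le_of_le_ofReal hδ0.le hbad
    linarith
  · have h1 : ω ∉ Φ ⁻¹' badSet H P n d δ α ∪ N := fun h => hω (subset_toMeasurable _ _ h)
    rw [Set.mem_union, not_or] at h1
    exact objectives_sub_le_of_notMem_badSet hn0 hα0 hα hP0 hP01 hstar_mem hstar_opt hL h1.1
      (not_not.1 h1.2)
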